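/- A (left) skew brace is a set with two group structures $+$ and $\circ$ such that $a\circ(b+c)=a\circ b-a+a\circ c$; it is \emph{trivial} if $+$ and $\circ$ coincide (the group need not be abelian). Write $\operatorname{Autb}$ for the group of skew brace automorphisms and $\lambda_a(b)=-a+a\circ b$. Let $H$ be a skew brace, $I$ a trivial skew brace, and $\mathcal E: 0\to I\xrightarrow{i} E\xrightarrow{\pi} H\to 0$ an extension of skew braces; regard $I$ as a subset of $E$. Let $s:H\to E$ be a map with $\pi s=\mathrm{id}_H$ and $s(0)=0$, and for $h,h_1,h_2\in H$ and $y\in I$ put $$\nu_h(y)=-s(h)+s(h)\circ y,\quad \mu_h(y)=-s(h)+y+s(h),\quad \sigma_h(y)=s(h)^{-1}\circ y\circ s(h),$$ $$\beta(h_1,h_2)=-s(h_1+h_2)+s(h_1)+s(h_2),\qquad \tau(h_1,h_2)=s(h_1\circ h_2)^{-1}\circ s(h_1)\circ s(h_2).$$ For triples of maps $H\to\operatorname{Aut}(I)$ write $(\nu',\mu',\sigma')\approx(\nu,\mu,\sigma)$ if there is a map $t:H\to I$ with $t(0)=0$ such that, for all $h$ and $y$, $\nu'_h(y)=\nu_h(\lambda_{t(h)}(y))=\nu_h(y)$,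 $\mu'_h(y)=\nu_h(-t(h))+\mu_h(y)+\nu_h(t(h))$ and $\sigma'_h(y)=t(h)^{-1}\circ\sigma_h(y)\circ t(h)$; the coupling $(\nu,\bar\mu,\bar\sigma)$ is the $\approx$-class of $(\nu,\mu,\sigma)$, which does not depend on $s$. For $(\phi,\theta)\in\operatorname{Autb}(H)\times\operatorname{Autb}(I)$ let $\mathcal E^{(\phi,\theta)}$ be the extension $0\to I\xrightarrow{i\theta}E\xrightarrow{\phi^{-1}\pi}H\to0$, and let $C=C_{(\nu,\bar\mu,\bar\sigma)}$ be the stabiliser of the coupling, that is, the subgroup of all $(\phi,\theta)$ with $$(\theta^{-1}\nu_{\phi(h)}\theta,\ \theta^{-1}\mu_{\phi(h)}\theta,\ \theta^{-1}\sigma_{\phi(h)}\theta)_{h\in H}\approx(\nu_h,\mu_h,\sigma_h)_{h\in H}.$$ Let $Z(I)$ be the centre of $I$, and let $\operatorname{Z}^2_N(H,Z(I))$ be the group of pairs $(g,f)$ of maps $H\times H\to Z(I)$ that vanish whenever one argument is $0$ and satisfy, for all $h_1,h_2,h_3\in H$, \begin{align*} & g(h_1,h_2+h_3)+g(h_2,h_3)-g(h_1+h_2,h_3)-\mu_{h_3}(g(h_1,h_2))=0,\\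 & f(h_1,h_2\circ h_3)+f(h_2,h_3)-f(h_1\circ h_2,h_3)-\sigma_{h_3}(f(h_1,h_2))=0,\\ & \nu_{h_1\circ(h_2+h_3)}(f(h_1,h_2+h_3))+\nu_{h_1}(g(h_2,h_3))=g(h_1\circ h_2-h_1,\,h_1\circ h_3)\\ &\quad+\mu_{h_1\circ h_3}\bigl(g(h_1\circ h_2,-h_1)+\mu_{-h_1}(\nu_{h_1\circ h_2}(f(h_1,h_2)))-g(h_1,-h_1)\bigr)+\nu_{h_1\circ h_3}(f(h_1,h_3)). \end{align*} Let $\operatorname{B}^2_N(H,Z(I))$ be the subgroup of those $(g,f)$ in it for which there is a map $t:H\to Z(I)$ with $g(h_1,h_2)=\nu_{h_1+h_2}(-t(h_1+h_2))+\mu_{h_2}(\nu_{h_1}(t(h_1)))+\nu_{h_2}(t(h_2))$ and $f(h_1,h_2)=-t(h_1\circ h_2)+\sigma_{h_2}(t(h_1))+t(h_2)$ for all $h_1,h_2$, and put $\operatorname{H}^2_N=\operatorname{Z}^2_N/\operatorname{B}^2_N$. The group $C$ acts on $\operatorname{H}^2_N(H,Z(I))$ from the right by $[(g,f)]^{(\phi,\theta)}=[(\theta^{-1}g(\phi(\cdot),\phi(\cdot)),\,\theta^{-1}f(\phi(\cdot),\phi(\cdot)))]$.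 For $(g,f)\in \operatorname{Z}^2_N(H,Z(I))$ let $\mathcal E_{(g,f)}$ be the extension $0\to I\to H\times I\to H\to0$ (maps $y\mapsto(0,y)$ and $(h,y)\mapsto h$), where $H\times I$ is the skew brace with \begin{align*} (h_1,y_1)+(h_2,y_2)&=\bigl(h_1+h_2,\ \nu_{h_1+h_2}^{-1}\bigl((g+\beta)(h_1,h_2)+\mu_{h_2}(\nu_{h_1}(y_1))+\nu_{h_2}(y_2)\bigr)\bigr),\\ (h_1,y_1)\circ(h_2,y_2)&=\bigl(h_1\circ h_2,\ (f+\tau)(h_1,h_2)\circ\sigma_{h_2}(y_1)\circ y_2\bigr). \end{align*} Let $\operatorname{Autb}_I(E)=\{\gamma\in\operatorname{Autb}(E)\mid\gamma(I)=I\}$. For $\gamma\in \operatorname{Autb}_I(E)$ let $\gamma_I$ be its restriction to $I$ and $\gamma_H$ the automorphism of $H$ that it induces, put $\rho(\mathcal E)(\gamma)=(\gamma_H,\gamma_I)$, and let $\operatorname{Autb}^{H,I}(E)=\{\gamma\in\operatorname{Autb}_I(E)\mid\gamma_I=\mathrm{id},\ \gamma_H=\mathrm{id}\}$. \textbf{Theorem.}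 The image of $\rho(\mathcal E)$ lies in $C$. For each $c\in C$ there is exactly one class $\omega(\mathcal E)(c)\in \operatorname{H}^2_N(H,Z(I))$ such that, for all $(g,f)\in\operatorname{Z}^2_N(H,Z(I))$, the extensions $\mathcal E^{c}$ and $\mathcal E_{(g,f)}$ are equivalent if and only if $[(g,f)]=\omega(\mathcal E)(c)$. The map $\omega(\mathcal E)$ is a derivation, $\omega(\mathcal E)(cd)=\omega(\mathcal E)(c)^{d}+\omega(\mathcal E)(d)$ for all $c,d\in C$, and the sequence $$0\to \operatorname{Autb}^{H,I}(E)\to\operatorname{Autb}_I(E)\xrightarrow{\rho(\mathcal E)}C\xrightarrow{\omega(\mathcal E)}\operatorname{H}^2_N(H,Z(I))$$ is exact, where $\operatorname{Ker}\omega(\mathcal E)=\{c\in C\mid\omega(\mathcal E)(c)=0\}$; in particular $\operatorname{Im}\rho(\mathcal E)=\operatorname{Ker}\omega(\mathcal E)$. In general $\omega(\mathcal E)$ is only a derivation: there are $H$, $I$ and $\mathcal E$ for which it is not a homomorphism. -/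

import Mathlib

universe u v w w'

/-- A left skew brace: a set with two group structures `+` and `∘` (the latter written `*`)
such that `a ∘ (b + c) = a ∘ b - a + a ∘ c`. Neither group is assumed commutative. -/
class SkewBrace (A : Type u) extends AddGroup A, Group A where
  mul_add_brace : ∀ a b c : A, a * (b + c) = a * b - a + a * c

/-- A skew brace is trivial if its two operations coincide. -/
class SkewBrace.IsTrivial (A : Type u) [SkewBrace A] : Prop where
  mul_eq_add : ∀ a b : A, a * b = a + b

namespace SkewBrace

variable {A : Type u} [SkewBrace A]

theorem one_eq_zero : (1 : A) = 0 := by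
  have h := mul_add_brace (1 : A) 0 0
  simpa using h.symm

theorem mul_zero_brace (a : A) : a * 0 = a := by
  rw [← one_eq_zero, mul_one]

theorem zero_mul_brace (a : A) : 0 * a = a := by
  rw [← one_eq_zero, one_mul]

theorem inv_mul_zero (a : A) : a⁻¹ * a = 0 := by
  rw [← one_eq_zero, inv_mul_cancel]

/-- The map `λ_a(b) = -a + a ∘ b`. -/
def lam (a b : A) : A := -a + a * b

theorem mul_eq_add_lam (a b : A) : a * b = a + lam a b := by simp [lam]

theorem lam_add (a b c : A) : lam a (b + c) = lam a b + lam a c := by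
  simp only [lam, mul_add_brace, sub_eq_add_neg, add_assoc]

theorem lam_zero (a : A) : lam a 0 = 0 := by simp [lam, mul_zero_brace]

theorem lam_neg (a b : A) : lam a (-b) = -lam a b := by
  apply eq_neg_of_add_eq_zero_left
  rw [← lam_add, neg_add_cancel, lam_zero]

theorem lam_mul (a b c : A) : lam (a * b) c = lam a (lam b c) := by
  have h : a * b * c = a * (b + lam b c) := by rw [mul_assoc, mul_eq_add_lam b c]
  rw [lam, h, mul_add_brace]
  simp only [lam, sub_eq_add_neg, add_assoc, neg_add_cancel_left]

theorem lam_one (b : A) : lam (1 : A) b = b := by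
  simp [lam, one_eq_zero, zero_mul_brace]

theorem lam_inv_lam (a b : A) : lam a⁻¹ (lam a b) = b := by
  rw [← lam_mul, inv_mul_cancel, lam_one]

theorem lam_lam_inv (a b : A) : lam a (lam a⁻¹ b) = b := by
  rw [← lam_mul, mul_inv_cancel, lam_one]

theorem inv_eq_neg [IsTrivial A] (a : A) : a⁻¹ = -a := by
  apply eq_neg_of_add_eq_zero_left
  rw [← IsTrivial.mul_eq_add, inv_mul_zero]

end SkewBrace

open SkewBrace

/-! ### Extensions -/

/-- An extension `0 → I → E → H → 0` of the skew brace `H` by the skew brace `I`. -/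
structure SkewBraceExt (H : Type u) (I : Type v) (E : Type w)
    [SkewBrace H] [SkewBrace I] [SkewBrace E] where
  inc : I → E
  proj : E → H
  inc_add : ∀ y z, inc (y + z) = inc y + inc z
  inc_mul : ∀ y z, inc (y * z) = inc y * inc z
  inc_injective : Function.Injective inc
  proj_add : ∀ a b, proj (a + b) = proj a + proj b
  proj_mul : ∀ a b, proj (a * b) = proj a * proj b
  proj_surjective : Function.Surjective proj
  exact : ∀ a, proj a = 0 ↔ ∃ y, inc y = a

namespace SkewBraceExt

variable {H : Type u} {I : Type v} {E : Type w} {E' : Type w'}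
  [SkewBrace H] [SkewBrace I] [SkewBrace E] [SkewBrace E']

/-- Equivalence of extensions. Here and below `≃+*` denotes a bijection preserving `+` and `∘`,
that is, an isomorphism of skew braces. -/
def Equivalent (X : SkewBraceExt H I E) (Y : SkewBraceExt H I E') : Prop :=
  ∃ f : E ≃+* E', (∀ y, f (X.inc y) = Y.inc y) ∧ ∀ a, Y.proj (f a) = X.proj a

/-- The extension `0 → I → E → H → 0` with maps `i ∘ θ` and `φ⁻¹ ∘ π`, for `c = (φ, θ)`. -/
def conj (X : SkewBraceExt H I E) (c : RingAut H × RingAut I) : SkewBraceExt H I E where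
  inc y := X.inc (c.2 y)
  proj a := c.1.symm (X.proj a)
  inc_add y z := by rw [map_add, X.inc_add]
  inc_mul y z := by rw [map_mul, X.inc_mul]
  inc_injective := X.inc_injective.comp c.2.injective
  proj_add a b := by rw [X.proj_add, map_add]
  proj_mul a b := by rw [X.proj_mul, map_mul]
  proj_surjective := c.1.symm.surjective.comp X.proj_surjective
  exact a := by
    have h0 : c.1 0 = 0 := by
      exact map_zero c.1.toAddEquiv
    constructor
    · intro h
      have h1 : X.proj a = 0 := by
        have h2 := congrArg c.1 h
        rwa [RingEquiv.apply_symm_apply, h0] at h2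
      obtain ⟨y, hy⟩ := (X.exact a).1 h1
      exact ⟨c.2.symm y, by rw [RingEquiv.apply_symm_apply, hy]⟩
    · rintro ⟨y, hy⟩
      rw [(X.exact a).2 ⟨_, hy⟩, RingEquiv.symm_apply_eq, h0]

/-- A set-theoretic section `s` of `π` with `s(0) = 0`. -/
structure STSection (X : SkewBraceExt H I E) where
  toFun : H → E
  proj_toFun : ∀ h, X.proj (toFun h) = h
  map_zero : toFun 0 = 0

variable (X : SkewBraceExt H I E)

theorem proj_inc (y : I) : X.proj (X.inc y) = 0 := (X.exact _).2 ⟨y, rfl⟩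

theorem proj_zero : X.proj 0 = 0 := by
  have h := X.proj_add 0 0
  rwa [add_zero, left_eq_add] at h

theorem proj_neg (a : E) : X.proj (-a) = -X.proj a := by
  apply eq_neg_of_add_eq_zero_left
  rw [← X.proj_add, neg_add_cancel, X.proj_zero]

theorem proj_inv (a : E) : X.proj a⁻¹ = (X.proj a)⁻¹ := by
  apply eq_inv_of_mul_eq_one_left
  rw [← X.proj_mul, inv_mul_cancel, one_eq_zero, one_eq_zero, X.proj_zero]

theorem inc_zero : X.inc 0 = 0 := by
  have h := X.inc_add 0 0
  simpa using h

theorem inc_neg (y : I) : X.inc (-y) = -X.inc y := by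
  apply eq_neg_of_add_eq_zero_left
  rw [← X.inc_add, neg_add_cancel, X.inc_zero]

/-- The element `y` of `I` with `i(y) = a`, for `a` in the kernel of `π`. -/
noncomputable def pre (a : E) (h : X.proj a = 0) : I := ((X.exact a).1 h).choose

@[simp] theorem inc_pre (a : E) (h : X.proj a = 0) : X.inc (X.pre a h) = a :=
  ((X.exact a).1 h).choose_spec

theorem proj_lam (a b : E) (h : X.proj b = 0) : X.proj (lam a b) = 0 := by
  rw [lam, X.proj_add, X.proj_neg, X.proj_mul, h, mul_zero_brace, neg_add_cancel]

/-- The automorphism `y ↦ -a + a ∘ y` of `(I, +)`, for `a` in `E`. -/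
noncomputable def nuAut (a : E) : I ≃+ I where
  toFun y := X.pre (lam a (X.inc y)) (X.proj_lam _ _ (X.proj_inc y))
  invFun y := X.pre (lam a⁻¹ (X.inc y)) (X.proj_lam _ _ (X.proj_inc y))
  left_inv y := X.inc_injective (by simp [lam_inv_lam])
  right_inv y := X.inc_injective (by simp [lam_lam_inv])
  map_add' y z := X.inc_injective (by simp [X.inc_add, lam_add])

/-- The automorphism `y ↦ -a + y + a` of `(I, +)`, for `a` in `E`. -/
noncomputable def muAut (a : E) : I ≃+ I where
  toFun y := X.pre (-a + X.inc y + a) (by simp [X.proj_add, X.proj_neg, X.proj_inc])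
  invFun y := X.pre (a + X.inc y + -a) (by simp [X.proj_add, X.proj_neg, X.proj_inc])
  left_inv y := X.inc_injective (by simp [add_assoc])
  right_inv y := X.inc_injective (by simp [add_assoc])
  map_add' y z := X.inc_injective (by simp [X.inc_add, add_assoc])

theorem proj_conjMul (a : E) (y : I) : X.proj (a⁻¹ * X.inc y * a) = 0 := by
  rw [X.proj_mul, X.proj_mul, X.proj_inc, mul_zero_brace, X.proj_inv, inv_mul_zero]

theorem proj_conjMul' (a : E) (y : I) : X.proj (a * X.inc y * a⁻¹) = 0 := by
  have h := X.proj_conjMul a⁻¹ y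
  rwa [inv_inv] at h

/-- The automorphism `y ↦ a⁻¹ ∘ y ∘ a` of `(I, ∘)`, for `a` in `E`. As `I` is trivial, this is
the same as an automorphism of `(I, +)`. -/
noncomputable def sigmaAut [IsTrivial I] (a : E) : I ≃+ I where
  toFun y := X.pre (a⁻¹ * X.inc y * a) (X.proj_conjMul a y)
  invFun y := X.pre (a * X.inc y * a⁻¹) (X.proj_conjMul' a y)
  left_inv y := X.inc_injective (by simp [mul_assoc])
  right_inv y := X.inc_injective (by simp [mul_assoc])
  map_add' y z := X.inc_injective (by
    simp only [← IsTrivial.mul_eq_add, X.inc_mul, inc_pre]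
    group)

theorem inc_nuAut (a : E) (y : I) : X.inc (X.nuAut a y) = lam a (X.inc y) := by simp [nuAut]

theorem inc_muAut (a : E) (y : I) : X.inc (X.muAut a y) = -a + X.inc y + a := by simp [muAut]

theorem inc_sigmaAut [IsTrivial I] (a : E) (y : I) :
    X.inc (X.sigmaAut a y) = a⁻¹ * X.inc y * a := by simp [sigmaAut]

end SkewBraceExt

/-! ### Actions and couplings -/

/-- A triple `χ = (ν, μ, σ)` of maps from `H` to the automorphisms of the trivial skew brace `I`. -/
structure ActionTriple (H : Type u) (I : Type v) [SkewBrace I] where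
  nu : H → I ≃+ I
  mu : H → I ≃+ I
  sigma : H → I ≃+ I

namespace ActionTriple

variable {H : Type u} {I : Type v} [SkewBrace H] [SkewBrace I]

/-- The relation `χ' ≈ χ`: for some `t : H → I` with `t(0) = 0`,
`ν'_h = ν_h λ_{t(h)}`, `μ'_h` is `μ_h` followed by `x ↦ ν_h(-t(h)) + x - ν_h(-t(h))`, and
`σ'_h` is `σ_h` followed by `x ↦ t(h)⁻¹ ∘ x ∘ t(h)`. The same `t` serves `ν`, `μ` and `σ`. -/
def Approx (χ' χ : ActionTriple H I) : Prop :=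
  ∃ t : H → I, t 0 = 0 ∧ ∀ h y,
    χ'.nu h y = χ.nu h (lam (t h) y) ∧
    χ'.mu h y = χ.nu h (-t h) + χ.mu h y - χ.nu h (-t h) ∧
    χ'.sigma h y = (t h)⁻¹ * χ.sigma h y * t h

/-- The triple `h ↦ (θ⁻¹ ν_{φ(h)} θ, θ⁻¹ μ_{φ(h)} θ, θ⁻¹ σ_{φ(h)} θ)`, for `c = (φ, θ)`. -/
def conj (χ : ActionTriple H I) (c : RingAut H × RingAut I) : ActionTriple H I where
  nu h := (c.2.toAddEquiv.trans (χ.nu (c.1 h))).trans c.2.toAddEquiv.symm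
  mu h := (c.2.toAddEquiv.trans (χ.mu (c.1 h))).trans c.2.toAddEquiv.symm
  sigma h := (c.2.toAddEquiv.trans (χ.sigma (c.1 h))).trans c.2.toAddEquiv.symm

theorem lam_of_trivial [IsTrivial I] (a b : I) : lam a b = b := by
  rw [lam, IsTrivial.mul_eq_add, neg_add_cancel_left]

theorem approx_iff [IsTrivial I] (χ' χ : ActionTriple H I) : Approx χ' χ ↔
    ∃ t : H → I, t 0 = 0 ∧ ∀ h y, χ'.nu h y = χ.nu h y ∧
      χ'.mu h y = -χ.nu h (t h) + χ.mu h y + χ.nu h (t h) ∧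
      χ'.sigma h y = -t h + χ.sigma h y + t h := by
  simp [Approx, lam_of_trivial, inv_eq_neg, IsTrivial.mul_eq_add]

theorem approx_refl [IsTrivial I] (χ : ActionTriple H I) : Approx χ χ :=
  (approx_iff _ _).2 ⟨fun _ => 0, rfl, by simp⟩

theorem approx_symm [IsTrivial I] {χ' χ : ActionTriple H I} (h : Approx χ' χ) : Approx χ χ' := by
  rw [approx_iff] at h ⊢
  obtain ⟨t, h0, ht⟩ := h
  refine ⟨fun h => -t h, by simp [h0], fun h y => ⟨((ht h y).1).symm, ?_, ?_⟩⟩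
  · simp [(ht h y).2.1, (ht h _).1, add_assoc]
  · simp [(ht h y).2.2, add_assoc]

theorem approx_trans [IsTrivial I] {χ₁ χ₂ χ₃ : ActionTriple H I} (h : Approx χ₁ χ₂)
    (h' : Approx χ₂ χ₃) : Approx χ₁ χ₃ := by
  rw [approx_iff] at h h' ⊢
  obtain ⟨t, h0, ht⟩ := h
  obtain ⟨r, h0', hr⟩ := h'
  refine ⟨fun h => r h + t h, by simp [h0, h0'], fun h y => ⟨?_, ?_, ?_⟩⟩
  · rw [(ht h y).1, (hr h y).1]
  · simp [(ht h y).2.1, (hr h _).1, (hr h y).2.1, add_assoc]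
  · simp [(ht h y).2.2, (hr h y).2.2, add_assoc]

theorem approx_conj [IsTrivial I] {χ' χ : ActionTriple H I} (h : Approx χ' χ)
    (c : RingAut H × RingAut I) : Approx (χ'.conj c) (χ.conj c) := by
  rw [approx_iff] at h ⊢
  obtain ⟨t, h0, ht⟩ := h
  have h1 : c.1 0 = 0 := map_zero c.1.toAddEquiv
  have hneg : ∀ x, c.2.symm (-x) = -c.2.symm x := fun x => map_neg c.2.toAddEquiv.symm x
  refine ⟨fun h => c.2.symm (t (c.1 h)), ?_, fun h y => ⟨?_, ?_, ?_⟩⟩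
  · simp only [h1, h0]
    exact map_zero c.2.toAddEquiv.symm
  · simp [conj, (ht _ _).1]
  · simp [conj, (ht _ _).2.1, hneg]
  · simp [conj, (ht _ _).2.2, hneg]

theorem conj_mul (χ : ActionTriple H I) (c d : RingAut H × RingAut I) :
    χ.conj (c * d) = (χ.conj c).conj d := rfl

/-- The group `C` of pairs `(φ, θ)` that stabilise the coupling of `χ`, i.e. that stabilise
the set of classes of extensions whose action is `≈ χ`. -/
def stabilizer [IsTrivial I] (χ : ActionTriple H I) : Subgroup (RingAut H × RingAut I) where
  carrier := {c | Approx (χ.conj c) χ}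
  one_mem' := approx_refl χ
  mul_mem' {c d} hc hd := approx_trans (approx_conj hc d) hd
  inv_mem' {c} hc := by
    have h := approx_symm (approx_conj hc c⁻¹)
    rwa [← conj_mul, mul_inv_cancel] at h

end ActionTriple

/-! ### The second cohomology group -/

section Cohomology

variable {H : Type u} {A : Type v} [SkewBrace H] [AddCommGroup A]

/-- The normalised 2-cocycles `(g, f)` of `H` with values in the abelian group `A`. -/
def Z2N (nu mu sigma : H → A →+ A) : AddSubgroup ((H → H → A) × (H → H → A)) where
  carrier := {p | (∀ h, p.1 0 h = 0 ∧ p.1 h 0 = 0 ∧ p.2 0 h = 0 ∧ p.2 h 0 = 0) ∧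
    (∀ h₁ h₂ h₃, p.1 h₁ (h₂ + h₃) + p.1 h₂ h₃ - p.1 (h₁ + h₂) h₃ - mu h₃ (p.1 h₁ h₂) = 0) ∧
    (∀ h₁ h₂ h₃, p.2 h₁ (h₂ * h₃) + p.2 h₂ h₃ - p.2 (h₁ * h₂) h₃ - sigma h₃ (p.2 h₁ h₂) = 0) ∧
    (∀ h₁ h₂ h₃, nu (h₁ * (h₂ + h₃)) (p.2 h₁ (h₂ + h₃)) + nu h₁ (p.1 h₂ h₃) =
      p.1 (h₁ * h₂ - h₁) (h₁ * h₃) +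
      mu (h₁ * h₃) (p.1 (h₁ * h₂) (-h₁) + mu (-h₁) (nu (h₁ * h₂) (p.2 h₁ h₂)) - p.1 h₁ (-h₁)) +
      nu (h₁ * h₃) (p.2 h₁ h₃))}
  zero_mem' := by simp
  add_mem' {p q} hp hq := by
    refine ⟨fun h => ?_, fun a b c => ?_, fun a b c => ?_, fun a b c => ?_⟩
    · simp [(hp.1 h), (hq.1 h)]
    · have h := congrArg₂ (· + ·) (hp.2.1 a b c) (hq.2.1 a b c)
      simp only [add_zero] at h
      rw [← h]
      simp only [Prod.fst_add, Pi.add_apply, map_add]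
      abel
    · have h := congrArg₂ (· + ·) (hp.2.2.1 a b c) (hq.2.2.1 a b c)
      simp only [add_zero] at h
      rw [← h]
      simp only [Prod.snd_add, Pi.add_apply, map_add]
      abel
    · have h := congrArg₂ (· + ·) (hp.2.2.2 a b c) (hq.2.2.2 a b c)
      simp only [Prod.fst_add, Prod.snd_add, Pi.add_apply, map_add, map_sub] at h ⊢
      rw [add_add_add_comm, h]
      abel
  neg_mem' {p} hp := by
    refine ⟨fun h => ?_, fun a b c => ?_, fun a b c => ?_, fun a b c => ?_⟩
    · simp [(hp.1 h)]
    · have h := congrArg (- ·) (hp.2.1 a b c)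
      simp only [neg_zero] at h
      rw [← h]
      simp only [Prod.fst_neg, Pi.neg_apply, map_neg]
      abel
    · have h := congrArg (- ·) (hp.2.2.1 a b c)
      simp only [neg_zero] at h
      rw [← h]
      simp only [Prod.snd_neg, Pi.neg_apply, map_neg]
      abel
    · have h := congrArg (- ·) (hp.2.2.2 a b c)
      simp only [Prod.fst_neg, Prod.snd_neg, Pi.neg_apply, map_neg, map_add, map_sub] at h ⊢
      rw [← neg_add, h]
      abel

/-- The 2-coboundaries, as a subgroup of the normalised 2-cocycles. -/
def B2N (nu mu sigma : H → A →+ A) : AddSubgroup (Z2N nu mu sigma) where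
  carrier := {p | ∃ t : H → A, ∀ h₁ h₂,
    p.1.1 h₁ h₂ = nu (h₁ + h₂) (-t (h₁ + h₂)) + mu h₂ (nu h₁ (t h₁)) + nu h₂ (t h₂) ∧
    p.1.2 h₁ h₂ = -t (h₁ * h₂) + sigma h₂ (t h₁) + t h₂}
  zero_mem' := ⟨fun _ => 0, by simp⟩
  add_mem' := by
    rintro p q ⟨t, ht⟩ ⟨r, hr⟩
    refine ⟨fun h => t h + r h, fun a b => ⟨?_, ?_⟩⟩
    · simp only [AddSubgroup.coe_add, Prod.fst_add, Pi.add_apply, (ht a b).1, (hr a b).1,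
        map_add, map_neg]
      abel
    · simp only [AddSubgroup.coe_add, Prod.snd_add, Pi.add_apply, (ht a b).2, (hr a b).2, map_add]
      abel
  neg_mem' := by
    rintro p ⟨t, ht⟩
    refine ⟨fun h => -t h, fun a b => ⟨?_, ?_⟩⟩
    · simp only [NegMemClass.coe_neg, Prod.fst_neg, Pi.neg_apply, (ht a b).1, map_neg]
      abel
    · simp only [NegMemClass.coe_neg, Prod.snd_neg, Pi.neg_apply, (ht a b).2, map_neg]
      abel

end Cohomology

namespace ActionTriple

variable {H : Type u} {I : Type v} [SkewBrace H] [SkewBrace I]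

/-- The centre of an additive group is commutative; its operations are the inherited ones. -/
instance centerAddCommGroup (G : Type v) [AddGroup G] : AddCommGroup (AddSubgroup.center G) where
  add_comm a b := Subtype.ext ((AddSubgroup.mem_center_iff.1 b.2) a)

/-- An automorphism of `(I, +)` restricted to the centre `Z(I)`. -/
def onCenter (f : I ≃+ I) : AddSubgroup.center I →+ AddSubgroup.center I where
  toFun z := ⟨f z, by
    rw [AddSubgroup.mem_center_iff]
    intro g
    have h := (AddSubgroup.mem_center_iff.1 z.2) (f.symm g)
    simpa using congrArg f h⟩
  map_zero' := by ext; simp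
  map_add' a b := by ext; simp

@[simp] theorem coe_onCenter (f : I ≃+ I) (z : AddSubgroup.center I) :
    (onCenter f z : I) = f z := rfl

/-- The group of normalised 2-cocycles of `H` with values in `Z(I)`. -/
abbrev Z2 (χ : ActionTriple H I) :
    AddSubgroup ((H → H → AddSubgroup.center I) × (H → H → AddSubgroup.center I)) :=
  Z2N (fun h => onCenter (χ.nu h)) (fun h => onCenter (χ.mu h)) (fun h => onCenter (χ.sigma h))

/-- The group of 2-coboundaries of `H` with values in `Z(I)`. -/
abbrev B2 (χ : ActionTriple H I) : AddSubgroup χ.Z2 :=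
  B2N (fun h => onCenter (χ.nu h)) (fun h => onCenter (χ.mu h)) (fun h => onCenter (χ.sigma h))

/-- The second cohomology group `H²_N(H, Z(I))`. -/
abbrev H2 (χ : ActionTriple H I) : Type (max u v) := χ.Z2 ⧸ χ.B2

variable [IsTrivial I]

theorem onCenter_conj (χ : ActionTriple H I) (c : χ.stabilizer) (h : H)
    (z : AddSubgroup.center I) :
    onCenter c.1.2.toAddEquiv.symm (onCenter (χ.nu (c.1.1 h)) z) =
      onCenter (χ.nu h) (onCenter c.1.2.toAddEquiv.symm z) ∧
    onCenter c.1.2.toAddEquiv.symm (onCenter (χ.mu (c.1.1 h)) z) =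
      onCenter (χ.mu h) (onCenter c.1.2.toAddEquiv.symm z) ∧
    onCenter c.1.2.toAddEquiv.symm (onCenter (χ.sigma (c.1.1 h)) z) =
      onCenter (χ.sigma h) (onCenter c.1.2.toAddEquiv.symm z) := by
  obtain ⟨t, -, ht⟩ := (approx_iff _ _).1 c.2
  have key := ht h (onCenter c.1.2.toAddEquiv.symm z : AddSubgroup.center I)
  have hm := AddSubgroup.mem_center_iff.1
    (onCenter (χ.mu h) (onCenter c.1.2.toAddEquiv.symm z)).2 (-χ.nu h (t h))
  have hs := AddSubgroup.mem_center_iff.1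
    (onCenter (χ.sigma h) (onCenter c.1.2.toAddEquiv.symm z)).2 (-t h)
  simp only [coe_onCenter] at hm hs key
  refine ⟨Subtype.ext ?_, Subtype.ext ?_, Subtype.ext ?_⟩
  · simpa [conj] using key.1
  · have h2 := key.2.1
    rw [hm] at h2
    simpa [conj] using h2
  · have h2 := key.2.2
    rw [hs] at h2
    simpa [conj] using h2

/-- The action of `c = (φ, θ)` on 2-cocycles: `g^c(h₁, h₂) = θ⁻¹(g(φ(h₁), φ(h₂)))`, and
likewise for `f`. -/
def actZ2 (χ : ActionTriple H I) (c : χ.stabilizer) : χ.Z2 →+ χ.Z2 where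
  toFun p := ⟨(fun h₁ h₂ => onCenter c.1.2.toAddEquiv.symm (p.1.1 (c.1.1 h₁) (c.1.1 h₂)),
      fun h₁ h₂ => onCenter c.1.2.toAddEquiv.symm (p.1.2 (c.1.1 h₁) (c.1.1 h₂))), by
    have k := onCenter_conj χ c
    have h0 : c.1.1 0 = 0 := map_zero c.1.1.toAddEquiv
    have hneg : ∀ x, c.1.1 (-x) = -c.1.1 x := fun x => map_neg c.1.1.toAddEquiv x
    have hsub : ∀ x y, c.1.1 (x - y) = c.1.1 x - c.1.1 y :=
      fun x y => map_sub c.1.1.toAddEquiv x y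
    refine ⟨fun h => ?_, fun a b d => ?_, fun a b d => ?_, fun a b d => ?_⟩
    · have := p.2.1 (c.1.1 h)
      simp [h0, this]
    · have := congrArg (onCenter c.1.2.toAddEquiv.symm)
        (p.2.2.1 (c.1.1 a) (c.1.1 b) (c.1.1 d))
      simpa only [map_add, map_sub, map_zero, k] using this
    · have := congrArg (onCenter c.1.2.toAddEquiv.symm)
        (p.2.2.2.1 (c.1.1 a) (c.1.1 b) (c.1.1 d))
      simpa only [map_add, map_sub, map_zero, map_mul, k] using this
    · have := congrArg (onCenter c.1.2.toAddEquiv.symm)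
        (p.2.2.2.2 (c.1.1 a) (c.1.1 b) (c.1.1 d))
      have k1 := k (a * (b + d))
      have k2 := k (a * d)
      have k3 := k (a * b)
      have k4 := k (-a)
      simp only [map_add, map_mul, hneg] at k1 k2 k3 k4
      simpa only [map_add, map_sub, map_mul, hneg, hsub, k, k1, k2, k3, k4] using this⟩
  map_zero' := by ext <;> simp
  map_add' p q := by ext <;> simp

/-- The action of `c` on `H²_N(H, Z(I))` induced by `actZ2`. -/
def actH2 (χ : ActionTriple H I) (c : χ.stabilizer) : χ.H2 →+ χ.H2 :=
  QuotientAddGroup.map χ.B2 χ.B2 (χ.actZ2 c) (by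
    rintro p ⟨t, ht⟩
    have k := onCenter_conj χ c
    refine ⟨fun h => onCenter c.1.2.toAddEquiv.symm (t (c.1.1 h)), fun a b => ⟨?_, ?_⟩⟩
    · have := congrArg (onCenter c.1.2.toAddEquiv.symm) (ht (c.1.1 a) (c.1.1 b)).1
      have k1 := k (a + b)
      simp only [map_add] at k1
      simpa only [actZ2, AddMonoidHom.coe_mk, ZeroHom.coe_mk, map_add, map_neg, k, k1]
        using this
    · have := congrArg (onCenter c.1.2.toAddEquiv.symm) (ht (c.1.1 a) (c.1.1 b)).2
      simpa only [actZ2, AddMonoidHom.coe_mk, ZeroHom.coe_mk, map_add, map_neg, map_mul, k]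
        using this)

end ActionTriple

/-! ### Action and cocycle of an extension; translation by a 2-cocycle -/

namespace SkewBraceExt

variable {H : Type u} {I : Type v} {E : Type w} [SkewBrace H] [SkewBrace I] [SkewBrace E]

/-- The action `(ν, μ, σ)` of the extension that corresponds to the section `s`:
`ν_h(y) = -s(h) + s(h) ∘ y`, `μ_h(y) = -s(h) + y + s(h)`, `σ_h(y) = s(h)⁻¹ ∘ y ∘ s(h)`. -/
noncomputable def action [IsTrivial I] (X : SkewBraceExt H I E) (s : X.STSection) :
    ActionTriple H I where
  nu h := X.nuAut (s.toFun h)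
  mu h := X.muAut (s.toFun h)
  sigma h := X.sigmaAut (s.toFun h)

/-- `β(h₁, h₂) = -s(h₁ + h₂) + s(h₁) + s(h₂)`. -/
noncomputable def beta (X : SkewBraceExt H I E) (s : X.STSection) (h₁ h₂ : H) : I :=
  X.pre (-s.toFun (h₁ + h₂) + s.toFun h₁ + s.toFun h₂)
    (by simp [X.proj_add, X.proj_neg, s.proj_toFun, add_assoc])

/-- `τ(h₁, h₂) = s(h₁ ∘ h₂)⁻¹ ∘ s(h₁) ∘ s(h₂)`. -/
noncomputable def tau (X : SkewBraceExt H I E) (s : X.STSection) (h₁ h₂ : H) : I :=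
  X.pre ((s.toFun (h₁ * h₂))⁻¹ * s.toFun h₁ * s.toFun h₂)
    (by simp [X.proj_mul, X.proj_inv, s.proj_toFun, mul_assoc, one_eq_zero])

variable [IsTrivial I] (X : SkewBraceExt H I E) (s : X.STSection) (z : (X.action s).Z2)

theorem inc_add_eq (a : E) (c : AddSubgroup.center I) :
    X.inc c + a = a + X.inc ((X.action s).mu (X.proj a) c) := by
  obtain ⟨y, hy⟩ := (X.exact (-s.toFun (X.proj a) + a)).1
    (by simp [X.proj_add, X.proj_neg, s.proj_toFun])
  have ha : a = s.toFun (X.proj a) + X.inc y := by rw [hy, add_neg_cancel_left]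
  have hc := AddSubgroup.mem_center_iff.1
    (ActionTriple.onCenter ((X.action s).mu (X.proj a)) c).2 y
  have h1 : X.inc c + s.toFun (X.proj a) =
      s.toFun (X.proj a) + X.inc ((X.action s).mu (X.proj a) c) := by
    simp [action, inc_muAut, add_assoc]
  generalize X.proj a = h at *
  rw [ha, ← add_assoc, h1, add_assoc, add_assoc, ← X.inc_add, ← X.inc_add]
  exact congrArg (fun w => s.toFun h + X.inc w) hc.symm

theorem inc_mul_eq (a : E) (c : AddSubgroup.center I) :
    X.inc c * a = a * X.inc ((X.action s).sigma (X.proj a) c) := by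
  obtain ⟨y, hy⟩ := (X.exact ((s.toFun (X.proj a))⁻¹ * a)).1
    (by rw [X.proj_mul, X.proj_inv, s.proj_toFun, inv_mul_zero])
  have ha : a = s.toFun (X.proj a) * X.inc y := by rw [hy, mul_inv_cancel_left]
  have hc := AddSubgroup.mem_center_iff.1
    (ActionTriple.onCenter ((X.action s).sigma (X.proj a)) c).2 y
  have h1 : X.inc c * s.toFun (X.proj a) =
      s.toFun (X.proj a) * X.inc ((X.action s).sigma (X.proj a) c) := by
    simp [action, inc_sigmaAut, mul_assoc]
  simp only [ActionTriple.coe_onCenter, ← IsTrivial.mul_eq_add] at hc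
  generalize X.proj a = h at *
  rw [ha, ← mul_assoc, h1, mul_assoc, mul_assoc, ← X.inc_mul, ← X.inc_mul, hc]

theorem mul_inc_eq (a : E) (y : I) :
    a * X.inc y = a + X.inc ((X.action s).nu (X.proj a) y) := by
  obtain ⟨x, hx⟩ := (X.exact ((s.toFun (X.proj a))⁻¹ * a)).1
    (by rw [X.proj_mul, X.proj_inv, s.proj_toFun, inv_mul_zero])
  have ha : a = s.toFun (X.proj a) * X.inc x := by rw [hx, mul_inv_cancel_left]
  have h1 : lam (X.inc x) (X.inc y) = X.inc y := by
    rw [lam, ← X.inc_mul, IsTrivial.mul_eq_add, X.inc_add, neg_add_cancel_left]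
  have h2 : lam a (X.inc y) = lam (s.toFun (X.proj a)) (X.inc y) := by
    conv_lhs => rw [ha]
    rw [lam_mul, h1]
  rw [mul_eq_add_lam, h2]
  simp [action, inc_nuAut]

/-- The set `H × I` underlying the extension with action `(ν, μ, σ)` and 2-cocycle
`(g + β, f + τ)`, where `(ν, μ, σ)`, `β` and `τ` are those of the extension `X` and its section
`s`, and `z = (g, f)` is a 2-cocycle with values in `Z(I)`. -/
@[ext] structure Translate (X : SkewBraceExt H I E) (s : X.STSection) (z : (X.action s).Z2) :
    Type (max u v) where
  fst : H
  snd : I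

namespace Translate

/-- `(h₁, y₁) + (h₂, y₂) = (h₁ + h₂, ν⁻¹_{h₁ + h₂}((g + β)(h₁, h₂) + μ_{h₂}(ν_{h₁}(y₁)) +
ν_{h₂}(y₂)))`. -/
noncomputable instance : Add (Translate X s z) where
  add p q := ⟨p.1 + q.1, ((X.action s).nu (p.1 + q.1)).symm
    (((z.1.1 p.1 q.1 : I) + X.beta s p.1 q.1) +
      (X.action s).mu q.1 ((X.action s).nu p.1 p.2) + (X.action s).nu q.1 q.2)⟩

/-- `(h₁, y₁) ∘ (h₂, y₂) = (h₁ ∘ h₂, (f + τ)(h₁, h₂) ∘ σ_{h₂}(y₁) ∘ y₂)`. -/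
noncomputable instance : Mul (Translate X s z) where
  mul p q := ⟨p.1 * q.1, ((z.1.2 p.1 q.1 : I) + X.tau s p.1 q.1) *
    (X.action s).sigma q.1 p.2 * q.2⟩

/-- The bijection `(h, y) ↦ s(h) ∘ y` from `H × I` to `E`. -/
noncomputable def toE : Translate X s z ≃ E where
  toFun p := s.toFun p.1 * X.inc p.2
  invFun a := ⟨X.proj a, X.pre ((s.toFun (X.proj a))⁻¹ * a)
    (by rw [X.proj_mul, X.proj_inv, s.proj_toFun, inv_mul_zero])⟩
  left_inv p := by
    have h : X.proj (s.toFun p.1 * X.inc p.2) = p.1 := by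
      rw [X.proj_mul, s.proj_toFun, X.proj_inc, mul_zero_brace]
    refine Translate.ext h (X.inc_injective ?_)
    simp [h]
  right_inv a := by simp

theorem proj_toE (p : Translate X s z) : X.proj (toE X s z p) = p.1 := by
  change X.proj (s.toFun p.1 * X.inc p.2) = p.1
  rw [X.proj_mul, s.proj_toFun, X.proj_inc, mul_zero_brace]

theorem toE_eq_add (p : Translate X s z) :
    toE X s z p = s.toFun p.1 + X.inc ((X.action s).nu p.1 p.2) := by
  change s.toFun p.1 * X.inc p.2 = _
  rw [X.mul_inc_eq s, s.proj_toFun]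

theorem toE_add (p q : Translate X s z) :
    toE X s z (p + q) = toE X s z p + toE X s z q + X.inc (z.1.1 p.1 q.1) := by
  have hb : s.toFun p.1 + s.toFun q.1 = s.toFun (p.1 + q.1) + X.inc (X.beta s p.1 q.1) := by
    simp [beta, add_assoc]
  have hm : ∀ y, X.inc y + s.toFun q.1 = s.toFun q.1 + X.inc ((X.action s).mu q.1 y) := by
    intro y
    simp [action, inc_muAut, add_assoc]
  have hz := AddSubgroup.mem_center_iff.1 (z.1.1 p.1 q.1).2
  have h1 : (p + q).1 = p.1 + q.1 := rfl
  have h2 : (X.action s).nu (p.1 + q.1) (p + q).2 =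
      ((z.1.1 p.1 q.1 : I) + X.beta s p.1 q.1) +
      (X.action s).mu q.1 ((X.action s).nu p.1 p.2) + (X.action s).nu q.1 q.2 :=
    AddEquiv.apply_symm_apply _ _
  rw [toE_eq_add, toE_eq_add, toE_eq_add, h1, h2]
  have h3 : s.toFun p.1 + X.inc ((X.action s).nu p.1 p.2) +
      (s.toFun q.1 + X.inc ((X.action s).nu q.1 q.2)) =
      s.toFun (p.1 + q.1) + X.inc (X.beta s p.1 q.1 +
        (X.action s).mu q.1 ((X.action s).nu p.1 p.2) + (X.action s).nu q.1 q.2) := by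
    rw [add_assoc, ← add_assoc (X.inc _), hm, X.inc_add, X.inc_add]
    simp only [← add_assoc]
    rw [hb]
  rw [h3, add_assoc (s.toFun _), ← X.inc_add, hz]
  simp only [add_assoc]

theorem toE_mul (p q : Translate X s z) :
    toE X s z (p * q) = toE X s z p * toE X s z q * X.inc (z.1.2 p.1 q.1) := by
  have ht : s.toFun p.1 * s.toFun q.1 = s.toFun (p.1 * q.1) * X.inc (X.tau s p.1 q.1) := by
    simp [tau, mul_assoc]
  have hm : ∀ y, X.inc y * s.toFun q.1 = s.toFun q.1 * X.inc ((X.action s).sigma q.1 y) := by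
    intro y
    simp [action, inc_sigmaAut, mul_assoc]
  have hz := AddSubgroup.mem_center_iff.1 (z.1.2 p.1 q.1).2
  simp only [← IsTrivial.mul_eq_add] at hz
  change s.toFun (p.1 * q.1) * X.inc (((z.1.2 p.1 q.1 : I) + X.tau s p.1 q.1) *
    (X.action s).sigma q.1 p.2 * q.2) = s.toFun p.1 * X.inc p.2 * (s.toFun q.1 * X.inc q.2) * _
  have h3 : s.toFun p.1 * X.inc p.2 * (s.toFun q.1 * X.inc q.2) =
      s.toFun (p.1 * q.1) * X.inc (X.tau s p.1 q.1 * (X.action s).sigma q.1 p.2 * q.2) := by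
    rw [mul_assoc, ← mul_assoc (X.inc _), hm, X.inc_mul, X.inc_mul]
    simp only [← mul_assoc]
    rw [ht]
  rw [h3, mul_assoc (s.toFun _), ← X.inc_mul, hz, ← IsTrivial.mul_eq_add]
  simp only [mul_assoc]

instance : Zero (Translate X s z) where
  zero := ⟨0, 0⟩

instance : One (Translate X s z) where
  one := ⟨0, 0⟩

noncomputable instance : Neg (Translate X s z) where
  neg p := (toE X s z).symm (-toE X s z p - X.inc (z.1.1 p.1 (-p.1)))

noncomputable instance : Inv (Translate X s z) where
  inv p := (toE X s z).symm ((toE X s z p)⁻¹ * (X.inc (z.1.2 p.1 p.1⁻¹))⁻¹)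

theorem toE_zero : toE X s z 0 = 0 := by
  change s.toFun 0 * X.inc 0 = 0
  rw [s.map_zero, X.inc_zero, mul_zero_brace]

theorem toE_one : toE X s z 1 = 0 := toE_zero X s z

theorem toE_neg (p : Translate X s z) :
    toE X s z (-p) = -toE X s z p - X.inc (z.1.1 p.1 (-p.1)) :=
  Equiv.apply_symm_apply _ _

theorem toE_inv (p : Translate X s z) :
    toE X s z p⁻¹ = (toE X s z p)⁻¹ * (X.inc (z.1.2 p.1 p.1⁻¹))⁻¹ :=
  Equiv.apply_symm_apply _ _

theorem fst_neg (p : Translate X s z) : (-p).1 = -p.1 := by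
  rw [← proj_toE X s z (-p), toE_neg, sub_eq_add_neg, X.proj_add, X.proj_neg, X.proj_neg,
    X.proj_inc, proj_toE, neg_zero, add_zero]

theorem fst_inv (p : Translate X s z) : p⁻¹.1 = p.1⁻¹ := by
  rw [← proj_toE X s z p⁻¹, toE_inv, X.proj_mul, X.proj_inv, X.proj_inv, X.proj_inc, proj_toE,
    ← one_eq_zero, inv_one, mul_one]

theorem fst_add (p q : Translate X s z) : (p + q).1 = p.1 + q.1 := rfl

theorem fst_mul (p q : Translate X s z) : (p * q).1 = p.1 * q.1 := rfl

noncomputable instance : AddGroup (Translate X s z) :=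
  AddGroup.ofRightAxioms
    (fun p q r => (toE X s z).injective (by
      have hc := z.2.2.1 p.1 q.1 r.1
      simp only [toE_add, fst_add]
      have h : z.1.1 p.1 (q.1 + r.1) + z.1.1 q.1 r.1 = z.1.1 (p.1 + q.1) r.1 +
          ActionTriple.onCenter ((X.action s).mu r.1) (z.1.1 p.1 q.1) := by
        rw [← sub_eq_zero, ← hc]
        abel
      rw [add_assoc _ (X.inc _) (toE X s z r), X.inc_add_eq s, proj_toE]
      simp only [add_assoc]
      congr 3
      rw [← X.inc_add, ← X.inc_add]
      congr 1
      have h' := congrArg Subtype.val ((add_comm _ _).trans (h.trans (add_comm _ _)))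
      exact h'.symm))
    (fun p => (toE X s z).injective (by
      have h : z.1.1 p.1 0 = 0 := (z.2.1 p.1).2.1
      have h0 : (0 : Translate X s z).1 = 0 := rfl
      rw [toE_add, toE_zero, h0, h, add_zero, AddSubgroup.coe_zero, X.inc_zero, add_zero]))
    (fun p => (toE X s z).injective (by
      rw [toE_add, toE_neg, fst_neg, toE_zero]
      simp [sub_eq_add_neg]))

noncomputable instance : Group (Translate X s z) :=
  Group.ofRightAxioms
    (fun p q r => (toE X s z).injective (by
      have hc := z.2.2.2.1 p.1 q.1 r.1
      simp only [toE_mul, fst_mul]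
      have h : z.1.2 p.1 (q.1 * r.1) + z.1.2 q.1 r.1 = z.1.2 (p.1 * q.1) r.1 +
          ActionTriple.onCenter ((X.action s).sigma r.1) (z.1.2 p.1 q.1) := by
        rw [← sub_eq_zero, ← hc]
        abel
      rw [mul_assoc _ (X.inc _) (toE X s z r), X.inc_mul_eq s, proj_toE]
      simp only [mul_assoc]
      congr 3
      rw [← X.inc_mul, ← X.inc_mul]
      congr 1
      have h' := congrArg Subtype.val ((add_comm _ _).trans (h.trans (add_comm _ _)))
      refine Eq.trans (IsTrivial.mul_eq_add _ _) (Eq.trans h'.symm ?_)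
      exact (IsTrivial.mul_eq_add _ _).symm))
    (fun p => (toE X s z).injective (by
      have h : z.1.2 p.1 0 = 0 := (z.2.1 p.1).2.2.2
      have h0 : (1 : Translate X s z).1 = 0 := rfl
      rw [toE_mul, toE_one, h0, h, mul_zero_brace, AddSubgroup.coe_zero, X.inc_zero,
        mul_zero_brace]))
    (fun p => (toE X s z).injective (by
      rw [toE_mul, toE_inv, fst_inv, toE_one]
      simp [one_eq_zero]))

noncomputable instance : SkewBrace (Translate X s z) where
  mul_add_brace p q r := (toE X s z).injective (by
    have hc := congrArg Subtype.val (z.2.2.2.2 p.1 q.1 r.1)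
    have hmul : ∀ a b : Translate X s z, toE X s z (a * b) =
        toE X s z a * toE X s z b +
          X.inc ((X.action s).nu (a.1 * b.1) (z.1.2 a.1 b.1)) := by
      intro a b
      rw [toE_mul, X.mul_inc_eq s, X.proj_mul, proj_toE, proj_toE]
    have hsub : ∀ a b : Translate X s z, a - b = a + -b := fun _ _ => rfl
    have hL : toE X s z (p * (q + r)) =
        toE X s z p * toE X s z q - toE X s z p + toE X s z p * toE X s z r +
        X.inc (((X.action s).nu p.1 (z.1.1 q.1 r.1)) +
          (X.action s).nu (p.1 * (q.1 + r.1)) (z.1.2 p.1 (q.1 + r.1))) := by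
      rw [hmul, toE_add, fst_add, mul_add_brace, mul_add_brace, X.mul_inc_eq s, proj_toE,
        X.inc_add]
      simp only [sub_eq_add_neg, add_assoc, neg_add_cancel_left]
    have hmv : ∀ (c : AddSubgroup.center I) (a : E), X.inc c + a =
        a + X.inc (ActionTriple.onCenter ((X.action s).mu (X.proj a)) c) :=
      fun c a => X.inc_add_eq s a c
    have hpr : X.proj (toE X s z p * toE X s z r) = p.1 * r.1 := by
      rw [X.proj_mul, proj_toE, proj_toE]
    have hpn : X.proj (-toE X s z p) = -p.1 := by rw [X.proj_neg, proj_toE]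
    let c1 : AddSubgroup.center I :=
      ActionTriple.onCenter ((X.action s).nu (p.1 * q.1)) (z.1.2 p.1 q.1)
    let c2 : AddSubgroup.center I := ActionTriple.onCenter ((X.action s).mu (-p.1)) c1 -
      z.1.1 p.1 (-p.1) + z.1.1 (p.1 * q.1) (-p.1)
    have h1 : toE X s z (p * q - p) =
        toE X s z p * toE X s z q - toE X s z p + X.inc c2 := by
      rw [hsub, toE_add, hmul, toE_neg, fst_neg, fst_mul]
      have := hmv c1 (-toE X s z p)
      rw [hpn] at this
      simp only [c2, AddSubgroup.coe_add, sub_eq_add_neg, X.inc_add,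
        X.inc_neg, AddSubgroup.coe_neg]
      simp only [← add_assoc]
      rw [add_assoc _ _ (-toE X s z p)]
      congr 2
      rw [add_assoc]
      exact congrArg (_ + ·) this
    have hR : toE X s z (p * q - p + p * r) =
        toE X s z p * toE X s z q - toE X s z p + toE X s z p * toE X s z r +
        X.inc (ActionTriple.onCenter ((X.action s).mu (p.1 * r.1)) c2 +
          ActionTriple.onCenter ((X.action s).nu (p.1 * r.1)) (z.1.2 p.1 r.1) +
          z.1.1 (p.1 * q.1 - p.1) (p.1 * r.1) : AddSubgroup.center I) := by
      have hf : (p * q - p).1 = p.1 * q.1 - p.1 := by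
        rw [hsub, fst_add, fst_neg, fst_mul, sub_eq_add_neg]
      have := hmv c2 (toE X s z p * toE X s z r)
      rw [hpr] at this
      rw [toE_add, h1, hmul, hf, fst_mul]
      simp only [AddSubgroup.coe_add, X.inc_add]
      rw [← add_assoc (_ + X.inc c2), add_assoc _ (X.inc c2), this]
      simp only [add_assoc]
      rfl
    rw [hL, hR]
    congr 2
    have hc' : ActionTriple.onCenter ((X.action s).nu p.1) (z.1.1 q.1 r.1) +
        ActionTriple.onCenter ((X.action s).nu (p.1 * (q.1 + r.1)))
          (z.1.2 p.1 (q.1 + r.1)) =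
        ActionTriple.onCenter ((X.action s).mu (p.1 * r.1)) c2 +
          ActionTriple.onCenter ((X.action s).nu (p.1 * r.1)) (z.1.2 p.1 r.1) +
          z.1.1 (p.1 * q.1 - p.1) (p.1 * r.1) := by
      have hz := z.2.2.2.2 p.1 q.1 r.1
      rw [add_comm, hz]
      have : c2 = z.1.1 (p.1 * q.1) (-p.1) +
          ActionTriple.onCenter ((X.action s).mu (-p.1)) c1 - z.1.1 p.1 (-p.1) := by
        simp only [c2]
        abel
      rw [this]
      simp only [c1]
      abel
    exact congrArg Subtype.val hc')

end Translate

/-- The extension `0 → I → H × I → H → 0` with action `(ν, μ, σ)` and 2-cocycle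
`(g + β, f + τ)`; its class is the result of letting the class of `z = (g, f)` in
`H²_N(H, Z(I))` act on the class of `X`. -/
noncomputable def translate : SkewBraceExt H I (Translate X s z) where
  inc y := ⟨0, y⟩
  proj p := p.1
  inc_add y y' := (Translate.toE X s z).injective (by
    have h : ∀ y, Translate.toE X s z ⟨0, y⟩ = X.inc y := fun y => by
      change s.toFun 0 * X.inc y = _
      rw [s.map_zero, zero_mul_brace]
    have hz : z.1.1 0 0 = 0 := (z.2.1 0).1
    rw [Translate.toE_add, h, h, h, hz, AddSubgroup.coe_zero, X.inc_zero, add_zero, X.inc_add])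
  inc_mul y y' := (Translate.toE X s z).injective (by
    have h : ∀ y, Translate.toE X s z ⟨0, y⟩ = X.inc y := fun y => by
      change s.toFun 0 * X.inc y = _
      rw [s.map_zero, zero_mul_brace]
    have hz : z.1.2 0 0 = 0 := (z.2.1 0).2.2.1
    rw [Translate.toE_mul, h, h, h, hz, AddSubgroup.coe_zero, X.inc_zero, mul_zero_brace,
      X.inc_mul])
  inc_injective y y' h := congrArg Translate.snd h
  proj_add _ _ := rfl
  proj_mul _ _ := rfl
  proj_surjective h := ⟨⟨h, 0⟩, rfl⟩
  exact p := ⟨fun h => ⟨p.2, Translate.ext h.symm rfl⟩, by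
    rintro ⟨y, rfl⟩
    rfl⟩

end SkewBraceExt

/-! ### Automorphisms of an extension -/

namespace SkewBraceExt

variable {H : Type u} {I : Type v} {E : Type w} [SkewBrace H] [SkewBrace I] [SkewBrace E]
  (X : SkewBraceExt H I E)

/-- The group `Autb_I(E)` of automorphisms `γ` of the skew brace `E` that normalise `I`, i.e.
with `γ(I) = I`. -/
def autbI : Subgroup (RingAut E) where
  carrier := {γ | γ '' Set.range X.inc = Set.range X.inc}
  one_mem' := by simp
  mul_mem' {γ δ} hγ hδ := by
    have h : (fun x => (γ * δ) x) = (fun x => γ x) ∘ fun x => δ x := rfl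
    change (fun x => (γ * δ) x) '' _ = _
    rw [h, Set.image_comp]
    exact (congrArg _ hδ).trans hγ
  inv_mem' {γ} hγ := by
    change (fun x => γ⁻¹ x) '' _ = _
    conv_lhs => rw [← show γ '' Set.range X.inc = Set.range X.inc from hγ]
    rw [← Set.image_comp]
    have h : (fun x => γ⁻¹ x) ∘ γ = id := funext fun x => γ.symm_apply_apply x
    rw [h, Set.image_id]

theorem proj_apply_inc (γ : X.autbI) (y : I) : X.proj (γ.1 (X.inc y)) = 0 := by
  have h : γ.1 (X.inc y) ∈ γ.1 '' Set.range X.inc := ⟨_, ⟨y, rfl⟩, rfl⟩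
  rw [show γ.1 '' Set.range X.inc = Set.range X.inc from γ.2] at h
  exact (X.exact _).2 h

theorem proj_apply_eq (γ : X.autbI) {a b : E} (h : X.proj a = X.proj b) :
    X.proj (γ.1 a) = X.proj (γ.1 b) := by
  obtain ⟨y, hy⟩ := (X.exact (-a + b)).1 (by rw [X.proj_add, X.proj_neg, h, neg_add_cancel])
  have hb : b = a + X.inc y := by rw [hy, add_neg_cancel_left]
  rw [hb, map_add, X.proj_add, X.proj_apply_inc, add_zero]

/-- The restriction `γ_I` of `γ` to `I`. -/
noncomputable def restrict (γ : X.autbI) : RingAut I where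
  toFun y := X.pre (γ.1 (X.inc y)) (X.proj_apply_inc γ y)
  invFun y := X.pre (γ⁻¹.1 (X.inc y)) (X.proj_apply_inc γ⁻¹ y)
  left_inv y := X.inc_injective (by
    rw [inc_pre, inc_pre]
    exact γ.1.symm_apply_apply _)
  right_inv y := X.inc_injective (by
    rw [inc_pre, inc_pre]
    exact γ.1.apply_symm_apply _)
  map_add' y z := X.inc_injective (by simp [X.inc_add])
  map_mul' y z := X.inc_injective (by simp [X.inc_mul])

theorem inc_restrict (γ : X.autbI) (y : I) : X.inc (X.restrict γ y) = γ.1 (X.inc y) :=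
  X.inc_pre _ (X.proj_apply_inc γ y)

/-- A preimage in `E` of an element of `H`. -/
noncomputable def someLift (h : H) : E := (X.proj_surjective h).choose

@[simp] theorem proj_someLift (h : H) : X.proj (X.someLift h) = h :=
  (X.proj_surjective h).choose_spec

/-- The automorphism `γ_H` of `H` induced by `γ`: it maps `h` to `π(γ(a))` for any `a` in `E`
with `π(a) = h`. -/
noncomputable def induced (γ : X.autbI) : RingAut H where
  toFun h := X.proj (γ.1 (X.someLift h))
  invFun h := X.proj (γ⁻¹.1 (X.someLift h))
  left_inv h := by
    have k := X.proj_apply_eq γ⁻¹ (X.proj_someLift (X.proj (γ.1 (X.someLift h))))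
    refine k.trans ((congrArg X.proj ?_).trans (X.proj_someLift h))
    exact γ.1.symm_apply_apply _
  right_inv h := by
    have k := X.proj_apply_eq γ (X.proj_someLift (X.proj (γ⁻¹.1 (X.someLift h))))
    refine k.trans ((congrArg X.proj ?_).trans (X.proj_someLift h))
    exact γ.1.apply_symm_apply _
  map_add' h k := by
    rw [← X.proj_add, ← map_add]
    exact X.proj_apply_eq γ (by simp [X.proj_add])
  map_mul' h k := by
    rw [← X.proj_mul, ← map_mul]
    exact X.proj_apply_eq γ (by simp [X.proj_mul])

theorem induced_proj (γ : X.autbI) (a : E) : X.induced γ (X.proj a) = X.proj (γ.1 a) :=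
  X.proj_apply_eq γ (X.proj_someLift _)

/-- The homomorphism `ρ : Autb_I(E) → Autb(H) × Autb(I)`, `γ ↦ (γ_H, γ_I)`. -/
noncomputable def rho : X.autbI →* RingAut H × RingAut I where
  toFun γ := (X.induced γ, X.restrict γ)
  map_one' := by
    refine Prod.ext (RingEquiv.ext fun h => ?_) (RingEquiv.ext fun y => X.inc_injective ?_)
    · obtain ⟨a, rfl⟩ := X.proj_surjective h
      exact X.induced_proj 1 a
    · exact X.inc_restrict 1 y
  map_mul' γ δ := by
    refine Prod.ext (RingEquiv.ext fun h => ?_) (RingEquiv.ext fun y => X.inc_injective ?_)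
    · obtain ⟨a, rfl⟩ := X.proj_surjective h
      change X.induced (γ * δ) (X.proj a) = X.induced γ (X.induced δ (X.proj a))
      rw [induced_proj, induced_proj, induced_proj]
      rfl
    · change X.inc (X.restrict (γ * δ) y) = X.inc (X.restrict γ (X.restrict δ y))
      rw [inc_restrict, inc_restrict, inc_restrict]
      rfl

/-- The group `Autb^{H,I}(E)` of all `γ` in `Autb_I(E)` with `γ_I = id` and `γ_H = id`. -/
noncomputable def autbHI : Subgroup X.autbI where
  carrier := {γ | X.restrict γ = 1 ∧ X.induced γ = 1}
  one_mem' := ⟨congrArg Prod.snd X.rho.map_one, congrArg Prod.fst X.rho.map_one⟩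
  mul_mem' {γ δ} hγ hδ := by
    have h := X.rho.map_mul γ δ
    refine ⟨(congrArg Prod.snd h).trans ?_, (congrArg Prod.fst h).trans ?_⟩
    · exact (congrArg₂ (· * ·) hγ.1 hδ.1).trans (mul_one 1)
    · exact (congrArg₂ (· * ·) hγ.2 hδ.2).trans (mul_one 1)
  inv_mem' {γ} hγ := by
    have h := X.rho.map_inv γ
    refine ⟨(congrArg Prod.snd h).trans ?_, (congrArg Prod.fst h).trans ?_⟩
    · exact (congrArg (·⁻¹) hγ.1).trans inv_one
    · exact (congrArg (·⁻¹) hγ.2).trans inv_one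

/-- The map `ω` is the Wells map of `X`: for `c` in `C`, the value `ω(c)` is the one and only
class in `H²_N(H, Z(I))` whose action on `[X]` gives `[X]^c`. -/
def IsWellsMap [IsTrivial I] (s : X.STSection)
    (ω : (X.action s).stabilizer → (X.action s).H2) : Prop :=
  ∀ (c : (X.action s).stabilizer) (z : (X.action s).Z2),
    (X.conj c).Equivalent (X.translate s z) ↔ QuotientAddGroup.mk z = ω c

end SkewBraceExt

/-!
Fix an extension `X` of `H` by the trivial skew brace `I`, with total space `E`. Everything is read
off from lifts: a lift of a pair `c = (φ, θ)` is a map `G : E → E` that covers `φ`, restricts to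
`θ` on `I`, and commutes with the translations by elements of `I`, both for `+` and for `∘`
(`SkewBraceExt.EquivariantLift`).

* A pair has a lift if and only if it stabilises the coupling (`EquivariantLift.mem_stabilizer`,
  `exists_equivariantLift`): the map `t` that witnesses the stabilisation is, up to sign and `θ`,
  the map `u` in `G(s(h)) = s(φ(h)) ∘ u(h)`.
* For a lift `G`, the elements `G(a) + G(b)` and `G(a + b)` act on `I` by conjugation in the same
  way, so they differ by a central element, which depends on `π(a)` and `π(b)` only; the same
  holds for `∘`. Hence `G` is a homomorphism up to a pair `z` of maps `H × H → Z(I)`, its defect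
  (`HasDefect`, `EquivariantLift.exists_hasDefect`). Associativity of `+` and `∘` and the brace
  identity in `E` say that `z` is a 2-cocycle (`HasDefect.mem_Z2`).
* Two lifts of the same pair differ by a map `t : H → Z(I)`, which changes the defect by the
  coboundary of `t`, and any normalised `t` arises (`HasDefect.mk_eq_mk`,
  `HasDefect.exists_of_mk_eq_mk`). So the defects of the lifts of `c` form one cohomology class.
* Inverting an equivalence from `X^c` to the translate of `X` by `z` gives a lift of `c` with
  defect `z`, and conversely (`conj_equivalent_translate_iff`). Therefore `ω(c)` is the class of
  the defects of the lifts of `c`.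
* Composing lifts gives the derivation rule (`HasDefect.comp`). Lifts with defect zero are the
  automorphisms of `E` that normalise `I`, which gives the equality of the image of `ρ` and the
  kernel of `ω` (`IsWellsMap.eq_zero_iff`).

For the extension `0 → ℤ/3 → ℤ/9 → ℤ/3 → 0` of trivial skew braces and `c = (id, -id)`, no
automorphism of `ℤ/9` induces `c`, so `ω(c) ≠ 0`. As `3ω(c) = 0` and `c² = 1`, the map `ω` is not a
homomorphism.
-/

/-! ### Translations by elements of the kernel -/

namespace SkewBrace

variable {A : Type u} [SkewBrace A]

theorem ringAut_zero (φ : RingAut A) : φ 0 = 0 := map_zero φ.toAddEquiv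

theorem ringAut_neg (φ : RingAut A) (a : A) : φ (-a) = -φ a := map_neg φ.toAddEquiv a

theorem ringAut_symm_zero (φ : RingAut A) : φ.symm 0 = 0 := map_zero φ.toAddEquiv.symm

theorem ringAut_symm_neg (φ : RingAut A) (a : A) : φ.symm (-a) = -φ.symm a :=
  map_neg φ.toAddEquiv.symm a

end SkewBrace

namespace SkewBraceExt

variable {H : Type u} {I : Type v} {E : Type w} [SkewBrace H] [SkewBrace I] [SkewBrace E]

theorem exists_add_inc (X : SkewBraceExt H I E) {a b : E} (h : X.proj a = X.proj b) :
    ∃ y, a = b + X.inc y := by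
  obtain ⟨y, hy⟩ := (X.exact (-b + a)).1 (by rw [X.proj_add, X.proj_neg, h, neg_add_cancel])
  exact ⟨y, by rw [hy, add_neg_cancel_left]⟩

theorem exists_mul_inc (X : SkewBraceExt H I E) {a b : E} (h : X.proj a = X.proj b) :
    ∃ y, a = b * X.inc y := by
  obtain ⟨y, hy⟩ := (X.exact (b⁻¹ * a)).1 (by rw [X.proj_mul, X.proj_inv, h, inv_mul_zero])
  exact ⟨y, by rw [hy, mul_inv_cancel_left]⟩

theorem proj_mul_inc (X : SkewBraceExt H I E) (a : E) (y : I) :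
    X.proj (a * X.inc y) = X.proj a := by rw [X.proj_mul, X.proj_inc, mul_zero_brace]

theorem inc_add_eq_add_inc_muAut (X : SkewBraceExt H I E) (a : E) (y : I) :
    X.inc y + a = a + X.inc (X.muAut a y) := by
  rw [inc_muAut, add_assoc, add_neg_cancel_left]

theorem inc_mul_eq_mul_inc_sigmaAut [IsTrivial I] (X : SkewBraceExt H I E) (a : E) (y : I) :
    X.inc y * a = a * X.inc (X.sigmaAut a y) := by
  rw [inc_sigmaAut, mul_assoc, mul_inv_cancel_left]

theorem mul_inc_eq_add_inc_nuAut (X : SkewBraceExt H I E) (a : E) (y : I) :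
    a * X.inc y = a + X.inc (X.nuAut a y) := by
  rw [inc_nuAut, mul_eq_add_lam]

theorem inc_mul_inc [IsTrivial I] (X : SkewBraceExt H I E) (y y' : I) :
    X.inc y * X.inc y' = X.inc y + X.inc y' := by
  rw [← X.inc_mul, IsTrivial.mul_eq_add, X.inc_add]

/-! ### Lifts and their defects -/

/-- A map `G : E → E` lifting `c = (φ, θ)`: it covers `φ` on `H`, and it commutes with all
translations by elements of `I`, where `I` is twisted by `θ`. Nothing is asked about sums and
products of two general elements of `E`. -/
structure EquivariantLift (X : SkewBraceExt H I E) (c : RingAut H × RingAut I) (G : E → E) :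
    Prop where
  proj_apply : ∀ a, X.proj (G a) = c.1 (X.proj a)
  apply_zero : G 0 = 0
  add_inc : ∀ a y, G (a + X.inc y) = G a + X.inc (c.2 y)
  inc_add : ∀ a y, G (X.inc y + a) = X.inc (c.2 y) + G a
  mul_inc : ∀ a y, G (a * X.inc y) = G a * X.inc (c.2 y)
  inc_mul : ∀ a y, G (X.inc y * a) = X.inc (c.2 y) * G a

/-- The embedding `w ↦ θ(w)` of the centre `Z(I)` into `E`, for an automorphism `θ` of `I`. -/
def centerInc (X : SkewBraceExt H I E) (θ : RingAut I) : AddSubgroup.center I →+ E where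
  toFun w := X.inc (θ w)
  map_zero' := by rw [AddSubgroup.coe_zero, ringAut_zero, X.inc_zero]
  map_add' w w' := by rw [AddSubgroup.coe_add, map_add, X.inc_add]

/-- The map `G : E → E` covers `φ`, restricts to `θ` on `I`, and is a homomorphism up to the
defect `z = (g, f)`: `G(a) + G(b) = G(a + b) + θ(g(π(a), π(b)))` and
`G(a) ∘ G(b) = G(a ∘ b) ∘ θ(f(π(a), π(b)))`. -/
structure HasDefect (X : SkewBraceExt H I E) (c : RingAut H × RingAut I)
    (z : (H → H → AddSubgroup.center I) × (H → H → AddSubgroup.center I)) (G : E → E) :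
    Prop where
  proj_apply : ∀ a, X.proj (G a) = c.1 (X.proj a)
  apply_inc : ∀ y, G (X.inc y) = X.inc (c.2 y)
  add_apply : ∀ a b, G a + G b = G (a + b) + X.centerInc c.2 (z.1 (X.proj a) (X.proj b))
  mul_apply : ∀ a b, G a * G b = G (a * b) * X.centerInc c.2 (z.2 (X.proj a) (X.proj b))

/-! ### Equivariant lifts and the stabiliser of the coupling -/

namespace EquivariantLift

variable {X : SkewBraceExt H I E} {c : RingAut H × RingAut I} {G : E → E}

theorem apply_inc (hG : X.EquivariantLift c G) (y : I) : G (X.inc y) = X.inc (c.2 y) := by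
  have h := hG.add_inc 0 y
  rwa [zero_add, hG.apply_zero, zero_add] at h

theorem nuAut_apply (hG : X.EquivariantLift c G) (a : E) (y : I) :
    X.nuAut (G a) (c.2 y) = c.2 (X.nuAut a y) := by
  have h := hG.mul_inc a y
  rw [mul_inc_eq_add_inc_nuAut, mul_inc_eq_add_inc_nuAut, hG.add_inc] at h
  exact (X.inc_injective (add_left_cancel h)).symm

theorem muAut_apply (hG : X.EquivariantLift c G) (a : E) (y : I) :
    X.muAut (G a) (c.2 y) = c.2 (X.muAut a y) := by
  have h := hG.inc_add a y
  rw [inc_add_eq_add_inc_muAut, inc_add_eq_add_inc_muAut, hG.add_inc] at h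
  exact (X.inc_injective (add_left_cancel h)).symm

theorem sigmaAut_apply [IsTrivial I] (hG : X.EquivariantLift c G) (a : E) (y : I) :
    X.sigmaAut (G a) (c.2 y) = c.2 (X.sigmaAut a y) := by
  have h := hG.inc_mul a y
  rw [inc_mul_eq_mul_inc_sigmaAut, inc_mul_eq_mul_inc_sigmaAut, hG.mul_inc] at h
  exact (X.inc_injective (mul_left_cancel h)).symm

variable [IsTrivial I]

/-- Writing `G(s(h)) = s(φ(h)) ∘ u(h)`, the map `t = -θ⁻¹ u` witnesses that `c` stabilises the
coupling. -/
theorem mem_stabilizer (hG : X.EquivariantLift c G) (s : X.STSection) :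
    c ∈ (X.action s).stabilizer := by
  have hu : ∀ h, ∃ u, G (s.toFun h) = s.toFun (c.1 h) * X.inc u := fun h =>
    X.exists_mul_inc (by rw [hG.proj_apply, s.proj_toFun, s.proj_toFun])
  choose u hu using hu
  -- As `I` is trivial, `λ` of an element of `I` is trivial on `I`, and the factor `u(h)` drops out.
  have hnu : ∀ h y, X.nuAut (s.toFun (c.1 h)) (c.2 y) = c.2 (X.nuAut (s.toFun h) y) := by
    intro h y
    rw [← hG.nuAut_apply]
    apply X.inc_injective
    rw [inc_nuAut, inc_nuAut, hu, lam_mul]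
    congr 1
    rw [lam, X.inc_mul_inc, neg_add_cancel_left]
  refine (ActionTriple.approx_iff _ _).2 ⟨fun h => -c.2.symm (u h), ?_, fun h y => ⟨?_, ?_, ?_⟩⟩
  · have h := hu 0
    rw [s.map_zero, ringAut_zero, hG.apply_zero, s.map_zero, zero_mul_brace, ← X.inc_zero] at h
    change -c.2.symm (u 0) = 0
    rw [← X.inc_injective h, ringAut_symm_zero, neg_zero]
  · change c.2.symm (X.nuAut (s.toFun (c.1 h)) (c.2 y)) = X.nuAut (s.toFun h) y
    rw [hnu, RingEquiv.symm_apply_apply]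
  · change c.2.symm (X.muAut (s.toFun (c.1 h)) (c.2 y)) = _
    rw [RingEquiv.symm_apply_eq]
    have h1 := hG.muAut_apply (s.toFun h) y
    have h2 : c.2 (X.nuAut (s.toFun h) (c.2.symm (u h))) = X.nuAut (s.toFun (c.1 h)) (u h) := by
      rw [← hnu, RingEquiv.apply_symm_apply]
    change _ = c.2 (-X.nuAut (s.toFun h) (-c.2.symm (u h)) + X.muAut (s.toFun h) y +
      X.nuAut (s.toFun h) (-c.2.symm (u h)))
    rw [map_neg, neg_neg, map_add, map_add, ringAut_neg, h2, ← h1]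
    apply X.inc_injective
    simp only [X.inc_add, X.inc_neg, inc_muAut, hu, mul_inc_eq_add_inc_nuAut, neg_add_rev,
      add_assoc, add_neg_cancel_left, add_neg_cancel, add_zero]
  · change c.2.symm (X.sigmaAut (s.toFun (c.1 h)) (c.2 y)) =
      - -c.2.symm (u h) + X.sigmaAut (s.toFun h) y + -c.2.symm (u h)
    have h1 := hG.sigmaAut_apply (s.toFun h) y
    rw [RingEquiv.symm_apply_eq, neg_neg, ← ringAut_symm_neg, map_add, map_add,
      RingEquiv.apply_symm_apply, RingEquiv.apply_symm_apply, ← h1, ← inv_eq_neg,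
      ← IsTrivial.mul_eq_add, ← IsTrivial.mul_eq_add]
    apply X.inc_injective
    have hi : X.inc (u h)⁻¹ = (X.inc (u h))⁻¹ := by
      apply eq_inv_of_mul_eq_one_left
      rw [← X.inc_mul, inv_mul_cancel, one_eq_zero, X.inc_zero, one_eq_zero]
    simp only [X.inc_mul, hi, inc_sigmaAut, hu]
    group

end EquivariantLift

/-- Every pair that stabilises the coupling has an equivariant lift: the witness `t` prescribes
`G(s(h) ∘ y) = s(φ(h)) ∘ θ(-t(h)) ∘ θ(y)`. -/
theorem exists_equivariantLift [IsTrivial I] (X : SkewBraceExt H I E) (s : X.STSection)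
    {c : RingAut H × RingAut I} (hc : c ∈ (X.action s).stabilizer) :
    ∃ G, X.EquivariantLift c G := by
  obtain ⟨t, ht0, ht⟩ := (ActionTriple.approx_iff _ _).1 hc
  -- The factor `θ(-t(h))` makes `I` act through `r(h)` as it does through `s(h)`, up to `θ`: see
  -- `hrnu`, `hrmu` and `hrsi`.
  let r : H → E := fun h => s.toFun (c.1 h) * X.inc (c.2 (-t h))
  have hpr : ∀ h, X.proj (r h) = c.1 h := fun h => by
    simp only [r, proj_mul_inc, s.proj_toFun]
  have hex : ∀ a : E, ∃ y, a = s.toFun (X.proj a) * X.inc y := fun a =>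
    X.exists_mul_inc (s.proj_toFun _).symm
  choose k hk using hex
  let G : E → E := fun a => r (X.proj a) * X.inc (c.2 (k a))
  have hGs : ∀ h y, G (s.toFun h * X.inc y) = r h * X.inc (c.2 y) := by
    intro h y
    have h1 := hk (s.toFun h * X.inc y)
    rw [proj_mul_inc, s.proj_toFun] at h1
    simp only [G, proj_mul_inc, s.proj_toFun]
    rw [← X.inc_injective (mul_left_cancel h1)]
  have hnu : ∀ h y, X.nuAut (s.toFun (c.1 h)) (c.2 y) = c.2 (X.nuAut (s.toFun h) y) :=
    fun h y => (RingEquiv.symm_apply_eq _).1 (ht h y).1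
  have hmu : ∀ h y, X.muAut (s.toFun (c.1 h)) (c.2 y) = c.2 (-X.nuAut (s.toFun h) (t h) +
      X.muAut (s.toFun h) y + X.nuAut (s.toFun h) (t h)) :=
    fun h y => (RingEquiv.symm_apply_eq _).1 (ht h y).2.1
  have hsi : ∀ h y, X.sigmaAut (s.toFun (c.1 h)) (c.2 y) = c.2 (-t h +
      X.sigmaAut (s.toFun h) y + t h) :=
    fun h y => (RingEquiv.symm_apply_eq _).1 (ht h y).2.2
  have hrnu : ∀ h y, X.nuAut (r h) (c.2 y) = c.2 (X.nuAut (s.toFun h) y) := by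
    intro h y
    rw [← hnu]
    apply X.inc_injective
    rw [inc_nuAut, inc_nuAut, lam_mul]
    congr 1
    rw [lam, X.inc_mul_inc, neg_add_cancel_left]
  have hradd : ∀ h y, r h * X.inc (c.2 y) = r h + X.inc (c.2 (X.nuAut (s.toFun h) y)) := by
    intro h y
    rw [mul_inc_eq_add_inc_nuAut, hrnu]
  have hrmu : ∀ h y, X.inc (c.2 y) + r h = r h + X.inc (c.2 (X.muAut (s.toFun h) y)) := by
    intro h y
    have h1 : r h = s.toFun (c.1 h) + X.inc (c.2 (-X.nuAut (s.toFun h) (t h))) := by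
      simp only [r]
      rw [mul_inc_eq_add_inc_nuAut, hnu, map_neg]
    rw [h1, ← add_assoc, inc_add_eq_add_inc_muAut, hmu]
    simp only [map_add, ringAut_neg, X.inc_add, X.inc_neg, add_assoc, add_neg_cancel, add_zero]
  have hrsi : ∀ h y, X.inc (c.2 y) * r h = r h * X.inc (c.2 (X.sigmaAut (s.toFun h) y)) := by
    intro h y
    simp only [r]
    rw [← mul_assoc, inc_mul_eq_mul_inc_sigmaAut, hsi, mul_assoc, mul_assoc, X.inc_mul_inc,
      X.inc_mul_inc]
    simp only [map_add, ringAut_neg, X.inc_add, X.inc_neg, add_assoc, add_neg_cancel, add_zero]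
  have hmul_inc : ∀ a y, G (a * X.inc y) = G a * X.inc (c.2 y) := by
    intro a y
    conv_lhs => rw [hk a]
    rw [mul_assoc, ← X.inc_mul, hGs, map_mul, X.inc_mul, ← mul_assoc]
  have hGadd : ∀ h y, G (s.toFun h + X.inc y) = r h + X.inc (c.2 y) := by
    intro h y
    have h1 := X.mul_inc_eq_add_inc_nuAut (s.toFun h) ((X.nuAut (s.toFun h)).symm y)
    rw [AddEquiv.apply_symm_apply] at h1
    rw [← h1, hGs, hradd, AddEquiv.apply_symm_apply]
  have hexa : ∀ a : E, ∃ y, a = s.toFun (X.proj a) + X.inc y := fun a =>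
    X.exists_add_inc (s.proj_toFun _).symm
  refine ⟨G, ?_, ?_, ?_, ?_, hmul_inc, ?_⟩
  · intro a
    simp only [G, proj_mul_inc, hpr]
  · have h1 := hGs 0 0
    simpa only [r, s.map_zero, X.inc_zero, mul_zero_brace, ringAut_zero, ht0, neg_zero] using h1
  · intro a y
    obtain ⟨x, hx⟩ := hexa a
    rw [hx, add_assoc, ← X.inc_add, hGadd, hGadd, map_add, X.inc_add, add_assoc]
  · intro a y
    obtain ⟨x, hx⟩ := hexa a
    rw [hx, ← add_assoc, inc_add_eq_add_inc_muAut, add_assoc, ← X.inc_add, hGadd, hGadd,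
      map_add, X.inc_add, ← add_assoc, ← add_assoc, hrmu]
  · intro a y
    rw [hk a, ← mul_assoc, inc_mul_eq_mul_inc_sigmaAut, mul_assoc, ← X.inc_mul, hGs, hGs,
      map_mul, X.inc_mul, ← mul_assoc, ← mul_assoc, hrsi]

/-! ### Existence of the defect -/

theorem centerInc_apply (X : SkewBraceExt H I E) (θ : RingAut I) (w : AddSubgroup.center I) :
    X.centerInc θ w = X.inc (θ w) := rfl

theorem centerInc_injective (X : SkewBraceExt H I E) (θ : RingAut I) :
    Function.Injective (X.centerInc θ) := fun _ _ h =>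
  Subtype.ext (θ.injective (X.inc_injective h))

theorem centerInc_mul [IsTrivial I] (X : SkewBraceExt H I E) (θ : RingAut I)
    (w w' : AddSubgroup.center I) :
    X.centerInc θ w * X.centerInc θ w' = X.centerInc θ (w + w') := by
  rw [map_add, centerInc_apply, centerInc_apply, inc_mul_inc]

theorem proj_mul_centerInc (X : SkewBraceExt H I E) (θ : RingAut I) (a : E)
    (w : AddSubgroup.center I) : X.proj (a * X.centerInc θ w) = X.proj a :=
  X.proj_mul_inc a _

namespace EquivariantLift

variable {X : SkewBraceExt H I E} {c : RingAut H × RingAut I} {G : E → E}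

theorem centerInc_add [IsTrivial I] (hG : X.EquivariantLift c G) (s : X.STSection)
    (w : AddSubgroup.center I) (a : E) :
    X.centerInc c.2 w + G a = G a +
      X.centerInc c.2 (ActionTriple.onCenter ((X.action s).mu (X.proj a)) w) := by
  rw [centerInc_apply, centerInc_apply, ← hG.inc_add, ← hG.add_inc, X.inc_add_eq s]
  rfl

theorem centerInc_mul [IsTrivial I] (hG : X.EquivariantLift c G) (s : X.STSection)
    (w : AddSubgroup.center I) (a : E) :
    X.centerInc c.2 w * G a = G a *
      X.centerInc c.2 (ActionTriple.onCenter ((X.action s).sigma (X.proj a)) w) := by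
  rw [centerInc_apply, centerInc_apply, ← hG.inc_mul, ← hG.mul_inc, X.inc_mul_eq s]
  rfl

theorem mul_centerInc [IsTrivial I] (hG : X.EquivariantLift c G) (s : X.STSection) (a : E)
    (w : AddSubgroup.center I) :
    G a * X.centerInc c.2 w = G a +
      X.centerInc c.2 (ActionTriple.onCenter ((X.action s).nu (X.proj a)) w) := by
  rw [centerInc_apply, centerInc_apply, ← hG.mul_inc, ← hG.add_inc, X.mul_inc_eq s]
  rfl

/-- Conjugation by `G(a) + G(b)` and by `G(a + b)` agree on `I`, so their difference commutes
with `I`. -/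
theorem exists_add_defect (hG : X.EquivariantLift c G) (a b : E) :
    ∃ w, G a + G b = G (a + b) + X.centerInc c.2 w := by
  obtain ⟨d, hd⟩ := X.exists_add_inc (a := G a + G b) (b := G (a + b))
    (by rw [X.proj_add, hG.proj_apply, hG.proj_apply, hG.proj_apply, X.proj_add, map_add])
  have hcomm : ∀ y, G (a + b) + (X.inc d + X.inc y) = G (a + b) + (X.inc y + X.inc d) := by
    intro y
    obtain ⟨x, rfl⟩ := c.2.surjective y
    obtain ⟨y₀, hy₀⟩ := (X.muAut (a + b)).surjective x
    have h1 : X.inc (c.2 y₀) + G (a + b) = G (a + b) + X.inc (c.2 x) := by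
      rw [← hG.inc_add, inc_add_eq_add_inc_muAut, hy₀, hG.add_inc]
    have hx : X.muAut b (X.muAut a y₀) = x := by
      rw [← hy₀]
      apply X.inc_injective
      simp only [inc_muAut, neg_add_rev, add_assoc]
    have h2 : X.inc (c.2 y₀) + (G a + G b) = G a + G b + X.inc (c.2 x) := by
      rw [← add_assoc, ← hG.inc_add, inc_add_eq_add_inc_muAut, hG.add_inc, add_assoc,
        ← hG.inc_add, inc_add_eq_add_inc_muAut, hG.add_inc, hx, add_assoc]
    rw [← add_assoc, ← hd, ← h2, hd, ← add_assoc, h1, add_assoc]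
  have hmem : c.2.symm d ∈ AddSubgroup.center I := AddSubgroup.mem_center_iff.2 fun y => by
    have h := add_left_cancel (hcomm (c.2 y))
    rw [← X.inc_add, ← X.inc_add] at h
    apply c.2.injective
    rw [map_add, map_add, RingEquiv.apply_symm_apply]
    exact (X.inc_injective h).symm
  refine ⟨⟨_, hmem⟩, ?_⟩
  rw [hd, centerInc_apply, RingEquiv.apply_symm_apply]

/-- Conjugation by `G(a) ∘ G(b)` and by `G(a ∘ b)` agree on `I`, so their quotient commutes
with `I`. -/
theorem exists_mul_defect [IsTrivial I] (hG : X.EquivariantLift c G) (a b : E) :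
    ∃ w, G a * G b = G (a * b) * X.centerInc c.2 w := by
  obtain ⟨d, hd⟩ := X.exists_mul_inc (a := G a * G b) (b := G (a * b))
    (by rw [X.proj_mul, hG.proj_apply, hG.proj_apply, hG.proj_apply, X.proj_mul, map_mul])
  have hcomm : ∀ y, G (a * b) * (X.inc d * X.inc y) = G (a * b) * (X.inc y * X.inc d) := by
    intro y
    obtain ⟨x, rfl⟩ := c.2.surjective y
    obtain ⟨y₀, hy₀⟩ := (X.sigmaAut (a * b)).surjective x
    have h1 : X.inc (c.2 y₀) * G (a * b) = G (a * b) * X.inc (c.2 x) := by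
      rw [← hG.inc_mul, inc_mul_eq_mul_inc_sigmaAut, hy₀, hG.mul_inc]
    have hx : X.sigmaAut b (X.sigmaAut a y₀) = x := by
      rw [← hy₀]
      apply X.inc_injective
      simp only [inc_sigmaAut, mul_inv_rev, mul_assoc]
    have h2 : X.inc (c.2 y₀) * (G a * G b) = G a * G b * X.inc (c.2 x) := by
      rw [← mul_assoc, ← hG.inc_mul, inc_mul_eq_mul_inc_sigmaAut, hG.mul_inc, mul_assoc,
        ← hG.inc_mul, inc_mul_eq_mul_inc_sigmaAut, hG.mul_inc, hx, mul_assoc]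
    rw [← mul_assoc, ← hd, ← h2, hd, ← mul_assoc, h1, mul_assoc]
  have hmem : c.2.symm d ∈ AddSubgroup.center I := AddSubgroup.mem_center_iff.2 fun y => by
    have h := mul_left_cancel (hcomm (c.2 y))
    rw [inc_mul_inc, inc_mul_inc, ← X.inc_add, ← X.inc_add] at h
    apply c.2.injective
    rw [map_add, map_add, RingEquiv.apply_symm_apply]
    exact (X.inc_injective h).symm
  refine ⟨⟨_, hmem⟩, ?_⟩
  rw [hd, centerInc_apply, RingEquiv.apply_symm_apply]

/-- The defects of an equivariant lift are constant on the cosets of `I`, hence are functions on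
`H × H`. -/
theorem exists_hasDefect [IsTrivial I] (hG : X.EquivariantLift c G) (s : X.STSection) :
    ∃ z, X.HasDefect c z G := by
  choose g hg using hG.exists_add_defect
  choose f hf using hG.exists_mul_defect
  refine ⟨(fun h k => g (s.toFun h) (s.toFun k), fun h k => f (s.toFun h) (s.toFun k)),
    hG.proj_apply, hG.apply_inc, fun a b => ?_, fun a b => ?_⟩
  · obtain ⟨y, hy⟩ := X.exists_add_inc (s.proj_toFun (X.proj a)).symm
    obtain ⟨x, hx⟩ := X.exists_add_inc (s.proj_toFun (X.proj b)).symm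
    generalize X.proj a = h at *
    generalize X.proj b = k at *
    subst hy hx
    have h1 : s.toFun h + X.inc y + (s.toFun k + X.inc x) =
        s.toFun h + s.toFun k + X.inc (X.muAut (s.toFun k) y + x) := by
      rw [add_assoc, ← add_assoc (X.inc y), inc_add_eq_add_inc_muAut, X.inc_add]
      simp only [add_assoc]
    have h2 : G (s.toFun h + X.inc y) + G (s.toFun k + X.inc x) =
        G (s.toFun h) + G (s.toFun k) + X.inc (c.2 (X.muAut (s.toFun k) y + x)) := by
      rw [hG.add_inc, hG.add_inc, add_assoc, ← add_assoc (X.inc _), ← hG.inc_add,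
        inc_add_eq_add_inc_muAut, hG.add_inc, map_add, X.inc_add]
      simp only [add_assoc]
    rw [h1, h2, hG.add_inc, hg, add_assoc, add_assoc, centerInc_apply, ← X.inc_add,
      ← X.inc_add, ← map_add, ← map_add,
      AddSubgroup.mem_center_iff.1 (g (s.toFun h) (s.toFun k)).2]
  · obtain ⟨y, hy⟩ := X.exists_mul_inc (s.proj_toFun (X.proj a)).symm
    obtain ⟨x, hx⟩ := X.exists_mul_inc (s.proj_toFun (X.proj b)).symm
    generalize X.proj a = h at *
    generalize X.proj b = k at *
    subst hy hx
    have h1 : s.toFun h * X.inc y * (s.toFun k * X.inc x) =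
        s.toFun h * s.toFun k * X.inc (X.sigmaAut (s.toFun k) y * x) := by
      rw [mul_assoc, ← mul_assoc (X.inc y), inc_mul_eq_mul_inc_sigmaAut, X.inc_mul]
      simp only [mul_assoc]
    have h2 : G (s.toFun h * X.inc y) * G (s.toFun k * X.inc x) =
        G (s.toFun h) * G (s.toFun k) * X.inc (c.2 (X.sigmaAut (s.toFun k) y * x)) := by
      rw [hG.mul_inc, hG.mul_inc, mul_assoc, ← mul_assoc (X.inc _), ← hG.inc_mul,
        inc_mul_eq_mul_inc_sigmaAut, hG.mul_inc, map_mul, X.inc_mul]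
      simp only [mul_assoc]
    rw [h1, h2, hG.mul_inc, hf, mul_assoc, mul_assoc, centerInc_apply, inc_mul_inc,
      inc_mul_inc, ← X.inc_add, ← X.inc_add, ← map_add, ← map_add,
      AddSubgroup.mem_center_iff.1 (f (s.toFun h) (s.toFun k)).2]

end EquivariantLift

/-! ### Defects are 2-cocycles -/

namespace HasDefect

variable {X : SkewBraceExt H I E} {c : RingAut H × RingAut I}
  {z : (H → H → AddSubgroup.center I) × (H → H → AddSubgroup.center I)} {G : E → E}

theorem apply_zero (hG : X.HasDefect c z G) : G 0 = 0 := by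
  rw [← X.inc_zero, hG.apply_inc, ringAut_zero]

theorem normalized (hG : X.HasDefect c z G) (h : H) :
    z.1 0 h = 0 ∧ z.1 h 0 = 0 ∧ z.2 0 h = 0 ∧ z.2 h 0 = 0 := by
  obtain ⟨a, rfl⟩ := X.proj_surjective h
  refine ⟨?_, ?_, ?_, ?_⟩ <;> apply X.centerInc_injective c.2 <;> rw [map_zero]
  · have h := hG.add_apply 0 a
    rwa [hG.apply_zero, zero_add, zero_add, X.proj_zero, left_eq_add] at h
  · have h := hG.add_apply a 0
    rwa [hG.apply_zero, add_zero, add_zero, X.proj_zero, left_eq_add] at h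
  · have h := hG.mul_apply 0 a
    rwa [hG.apply_zero, zero_mul_brace, zero_mul_brace, X.proj_zero, left_eq_mul,
      one_eq_zero] at h
  · have h := hG.mul_apply a 0
    rwa [hG.apply_zero, mul_zero_brace, mul_zero_brace, X.proj_zero, left_eq_mul,
      one_eq_zero] at h

theorem equivariantLift (hG : X.HasDefect c z G) : X.EquivariantLift c G where
  proj_apply := hG.proj_apply
  apply_zero := hG.apply_zero
  add_inc a y := by
    rw [← hG.apply_inc, hG.add_apply, X.proj_inc, (hG.normalized _).2.1, map_zero, add_zero]
  inc_add a y := by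
    rw [← hG.apply_inc, hG.add_apply, X.proj_inc, (hG.normalized _).1, map_zero, add_zero]
  mul_inc a y := by
    rw [← hG.apply_inc, hG.mul_apply, X.proj_inc, (hG.normalized _).2.2.2, map_zero,
      mul_zero_brace]
  inc_mul a y := by
    rw [← hG.apply_inc, hG.mul_apply, X.proj_inc, (hG.normalized _).2.2.1, map_zero,
      mul_zero_brace]

/-- The three cocycle identities come from expanding `G(a) + G(b) + G(d)`,
`G(a) ∘ G(b) ∘ G(d)` and `G(a) ∘ (G(b) + G(d))` in two ways. -/
theorem mem_Z2 [IsTrivial I] (hG : X.HasDefect c z G) (s : X.STSection) : z ∈ (X.action s).Z2 := by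
  have hE := hG.equivariantLift
  refine ⟨hG.normalized, fun h₁ h₂ h₃ => ?_, fun h₁ h₂ h₃ => ?_, fun h₁ h₂ h₃ => ?_⟩ <;>
    obtain ⟨a, rfl⟩ := X.proj_surjective h₁ <;> obtain ⟨b, rfl⟩ := X.proj_surjective h₂ <;>
    obtain ⟨d, rfl⟩ := X.proj_surjective h₃
  · have h := add_assoc (G a) (G b) (G d)
    rw [hG.add_apply a b, add_assoc, hE.centerInc_add s, ← add_assoc, hG.add_apply (a + b) d,
      hG.add_apply b d, ← add_assoc (G a), hG.add_apply a (b + d), add_assoc a b d,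
      add_assoc (G _), add_assoc (G _), ← map_add, ← map_add, add_right_inj, X.proj_add, X.proj_add] at h
    have h := X.centerInc_injective _ h
    rw [← h]
    abel
  · have h := mul_assoc (G a) (G b) (G d)
    rw [hG.mul_apply a b, mul_assoc, hE.centerInc_mul s, ← mul_assoc, hG.mul_apply (a * b) d,
      hG.mul_apply b d, ← mul_assoc (G a), hG.mul_apply a (b * d), mul_assoc a b d,
      mul_assoc (G _), mul_assoc (G _), X.centerInc_mul, X.centerInc_mul, mul_right_inj, X.proj_mul,
      X.proj_mul] at h
    have h := X.centerInc_injective _ h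
    rw [← h]
    abel
  · have hmul : ∀ x y, G x * G y = G (x * y) + X.centerInc c.2
        (ActionTriple.onCenter ((X.action s).nu (X.proj x * X.proj y))
          (z.2 (X.proj x) (X.proj y))) := fun x y => by
      rw [hG.mul_apply, hE.mul_centerInc s, X.proj_mul]
    have hneg : -G a = G (-a) - X.centerInc c.2 (z.1 (X.proj a) (-X.proj a)) := by
      have h := hG.add_apply a (-a)
      rw [add_neg_cancel, hG.apply_zero, zero_add, X.proj_neg] at h
      rw [← h, sub_eq_add_neg, neg_add_rev, add_neg_cancel_left]
    have hL : G a * (G b + G d) = G (a * (b + d)) + X.centerInc c.2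
        (ActionTriple.onCenter ((X.action s).nu (X.proj a * (X.proj b + X.proj d)))
            (z.2 (X.proj a) (X.proj b + X.proj d)) +
          ActionTriple.onCenter ((X.action s).nu (X.proj a)) (z.1 (X.proj b) (X.proj d))) := by
      have h1 : ∀ x w, G x * (G (b + d) + X.centerInc c.2 w) = G x * G (b + d) +
          X.centerInc c.2 (ActionTriple.onCenter ((X.action s).nu (X.proj x)) w) := by
        intro x w
        rw [mul_add_brace, hE.mul_centerInc s, sub_eq_add_neg, add_assoc, neg_add_cancel_left]
      rw [hG.add_apply, h1, hmul, add_assoc, ← map_add, X.proj_add]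
    have hab : G a * G b - G a = G (a * b - a) + X.centerInc c.2
        (z.1 (X.proj a * X.proj b) (-X.proj a) +
          ActionTriple.onCenter ((X.action s).mu (-X.proj a))
            (ActionTriple.onCenter ((X.action s).nu (X.proj a * X.proj b))
              (z.2 (X.proj a) (X.proj b))) - z.1 (X.proj a) (-X.proj a)) := by
      rw [sub_eq_add_neg, hneg, hmul, sub_eq_add_neg, add_assoc, ← add_assoc (X.centerInc _ _),
        hE.centerInc_add s, ← add_assoc, ← add_assoc, hG.add_apply, sub_eq_add_neg (a * b),
        add_assoc, add_assoc, ← map_neg, ← map_add, ← map_add, X.proj_mul, X.proj_neg,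
        sub_eq_add_neg, add_assoc]
    have hR : G a * G b - G a + G a * G d = G (a * b - a + a * d) + X.centerInc c.2
        (z.1 (X.proj a * X.proj b - X.proj a) (X.proj a * X.proj d) +
          ActionTriple.onCenter ((X.action s).mu (X.proj a * X.proj d))
            (z.1 (X.proj a * X.proj b) (-X.proj a) +
              ActionTriple.onCenter ((X.action s).mu (-X.proj a))
                (ActionTriple.onCenter ((X.action s).nu (X.proj a * X.proj b))
                  (z.2 (X.proj a) (X.proj b))) - z.1 (X.proj a) (-X.proj a)) +
          ActionTriple.onCenter ((X.action s).nu (X.proj a * X.proj d))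
            (z.2 (X.proj a) (X.proj d))) := by
      rw [hab, hmul, add_assoc, ← add_assoc (X.centerInc _ _), hE.centerInc_add s, ← add_assoc,
        ← add_assoc, hG.add_apply, add_assoc, add_assoc, ← map_add, ← map_add, X.proj_mul,
        sub_eq_add_neg (a * b), X.proj_add, X.proj_mul, X.proj_neg,
        ← sub_eq_add_neg (X.proj a * X.proj b), add_assoc (z.1 _ _)]
    have h := mul_add_brace (G a) (G b) (G d)
    rw [hL, hR, mul_add_brace, add_right_inj] at h
    exact X.centerInc_injective _ h

end HasDefect

/-! ### The cohomology class of a defect -/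

/-- The lifts `G` and `G'` act on `I` in the same way, so they differ by a central element, and
this element is constant on the cosets of `I`. -/
theorem EquivariantLift.exists_eq_mul_centerInc [IsTrivial I] {X : SkewBraceExt H I E}
    {c : RingAut H × RingAut I} {G G' : E → E} (hG : X.EquivariantLift c G)
    (hG' : X.EquivariantLift c G') (s : X.STSection) :
    ∃ t : H → AddSubgroup.center I, t 0 = 0 ∧
      ∀ a, G' a = G a * X.centerInc c.2 (t (X.proj a)) := by
  have key : ∀ a, ∃ w, G' a = G a * X.centerInc c.2 w := by
    intro a
    obtain ⟨d, hd⟩ := X.exists_mul_inc (a := G' a) (b := G a)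
      (by rw [hG.proj_apply, hG'.proj_apply])
    -- Conjugation by `G(a)` and by `G'(a)` carries `θ(y₀)` to `θ(y)`, so `d` commutes with `θ(y)`.
    have hmem : c.2.symm d ∈ AddSubgroup.center I := AddSubgroup.mem_center_iff.2 fun y => by
      obtain ⟨y₀, hy₀⟩ := (X.sigmaAut a).surjective y
      have h1 := hG.inc_mul a y₀
      have h2 := hG'.inc_mul a y₀
      rw [inc_mul_eq_mul_inc_sigmaAut, hG.mul_inc, hy₀] at h1
      rw [inc_mul_eq_mul_inc_sigmaAut, hG'.mul_inc, hy₀, hd, ← mul_assoc, ← h1, mul_assoc,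
        mul_assoc, mul_right_inj, inc_mul_inc, inc_mul_inc, ← X.inc_add, ← X.inc_add] at h2
      apply c.2.injective
      rw [map_add, map_add, RingEquiv.apply_symm_apply]
      exact (X.inc_injective h2).symm
    exact ⟨⟨_, hmem⟩, by rw [hd, centerInc_apply, RingEquiv.apply_symm_apply]⟩
  choose w hw using key
  refine ⟨fun h => w (s.toFun h), ?_, fun a => ?_⟩
  · have h := hw 0
    rw [hG.apply_zero, hG'.apply_zero, zero_mul_brace] at h
    apply X.centerInc_injective c.2
    change X.centerInc c.2 (w (s.toFun 0)) = _
    rw [s.map_zero, ← h, map_zero]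
  · obtain ⟨y, hy⟩ := X.exists_mul_inc (s.proj_toFun (X.proj a)).symm
    generalize X.proj a = h at *
    rw [hy, hG.mul_inc, hG'.mul_inc, hw, mul_assoc, mul_assoc, centerInc_apply, inc_mul_inc,
      inc_mul_inc, ← X.inc_add, ← X.inc_add, ← map_add, ← map_add,
      AddSubgroup.mem_center_iff.1 (w (s.toFun h)).2]

theorem EquivariantLift.bijective {X : SkewBraceExt H I E} {c : RingAut H × RingAut I}
    {G : E → E} (hG : X.EquivariantLift c G) : Function.Bijective G := by
  refine ⟨fun a b h => ?_, fun b => ?_⟩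
  · have h1 : X.proj a = X.proj b := c.1.injective (by rw [← hG.proj_apply, h, hG.proj_apply])
    obtain ⟨y, rfl⟩ := X.exists_add_inc h1
    rw [hG.add_inc, add_eq_left, ← X.inc_zero, ← ringAut_zero c.2] at h
    rw [c.2.injective (X.inc_injective h), X.inc_zero, add_zero]
  · obtain ⟨a, ha⟩ := X.proj_surjective (c.1.symm (X.proj b))
    obtain ⟨y, hy⟩ := X.exists_add_inc (a := b) (b := G a)
      (by rw [hG.proj_apply, ha, RingEquiv.apply_symm_apply])
    exact ⟨a + X.inc (c.2.symm y), by rw [hG.add_inc, RingEquiv.apply_symm_apply, hy]⟩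

namespace HasDefect

variable {X : SkewBraceExt H I E} {c : RingAut H × RingAut I}
  {z : (H → H → AddSubgroup.center I) × (H → H → AddSubgroup.center I)} {G : E → E}

theorem defect_unique (hG : X.HasDefect c z G)
    {z' : (H → H → AddSubgroup.center I) × (H → H → AddSubgroup.center I)}
    (hG' : X.HasDefect c z' G) : z = z' := by
  refine Prod.ext (funext₂ fun h k => ?_) (funext₂ fun h k => ?_) <;>
    obtain ⟨a, rfl⟩ := X.proj_surjective h <;> obtain ⟨b, rfl⟩ := X.proj_surjective k <;>
    apply X.centerInc_injective c.2
  · exact add_left_cancel ((hG.add_apply a b).symm.trans (hG'.add_apply a b))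
  · exact mul_left_cancel ((hG.mul_apply a b).symm.trans (hG'.mul_apply a b))

/-- Changing a lift by a central map `t` changes its defect by the coboundary of `t`. -/
theorem twist [IsTrivial I] (hG : X.HasDefect c z G) (s : X.STSection)
    {t : H → AddSubgroup.center I} (ht : t 0 = 0)
    {z' : (H → H → AddSubgroup.center I) × (H → H → AddSubgroup.center I)}
    (hz' : ∀ h₁ h₂,
      z'.1 h₁ h₂ = z.1 h₁ h₂ +
        (ActionTriple.onCenter ((X.action s).nu (h₁ + h₂)) (-t (h₁ + h₂)) +
          ActionTriple.onCenter ((X.action s).mu h₂)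
            (ActionTriple.onCenter ((X.action s).nu h₁) (t h₁)) +
          ActionTriple.onCenter ((X.action s).nu h₂) (t h₂)) ∧
      z'.2 h₁ h₂ = z.2 h₁ h₂ +
        (-t (h₁ * h₂) + ActionTriple.onCenter ((X.action s).sigma h₂) (t h₁) + t h₂)) :
    X.HasDefect c z' fun a => G a * X.centerInc c.2 (t (X.proj a)) := by
  have hE := hG.equivariantLift
  refine ⟨fun a => ?_, fun y => ?_, fun a b => ?_, fun a b => ?_⟩
  · rw [proj_mul_centerInc, hG.proj_apply]
  · rw [X.proj_inc, ht, map_zero, mul_zero_brace, hG.apply_inc]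
  · rw [hE.mul_centerInc s, hE.mul_centerInc s, hE.mul_centerInc s, add_assoc,
      ← add_assoc (X.centerInc _ _), hE.centerInc_add s, ← add_assoc, ← add_assoc,
      hG.add_apply, add_assoc, add_assoc, add_assoc, ← map_add, ← map_add, ← map_add,
      X.proj_add, (hz' _ _).1, map_neg]
    congr 2
    abel
  · rw [mul_assoc, ← mul_assoc (X.centerInc _ _), hE.centerInc_mul s, ← mul_assoc, ← mul_assoc,
      hG.mul_apply, mul_assoc, mul_assoc, mul_assoc, X.centerInc_mul, X.centerInc_mul,
      X.centerInc_mul, X.proj_mul, (hz' _ _).2]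
    congr 2
    abel

/-- The class of the defect depends on `c` only. -/
theorem mk_eq_mk [IsTrivial I] {s : X.STSection} {z z' : (X.action s).Z2} {G G' : E → E}
    (hG : X.HasDefect c z.1 G) (hG' : X.HasDefect c z'.1 G') :
    (QuotientAddGroup.mk z : (X.action s).H2) = QuotientAddGroup.mk z' := by
  obtain ⟨t, ht0, ht⟩ := hG.equivariantLift.exists_eq_mul_centerInc hG'.equivariantLift s
  have h := hG.twist s ht0 (z' := (_, _)) fun h₁ h₂ => ⟨rfl, rfl⟩
  rw [← funext ht] at h
  have h' := hG'.defect_unique h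
  rw [QuotientAddGroup.eq]
  refine ⟨t, fun h₁ h₂ => ⟨?_, ?_⟩⟩
  · have := congrArg (fun p => -z.1.1 h₁ h₂ + p.1 h₁ h₂) h'
    simp only [neg_add_cancel_left] at this
    exact this
  · have := congrArg (fun p => -z.1.2 h₁ h₂ + p.2 h₁ h₂) h'
    simp only [neg_add_cancel_left] at this
    exact this

/-- Every cocycle in the class of a defect is a defect. -/
theorem exists_of_mk_eq_mk [IsTrivial I] {s : X.STSection} {z z' : (X.action s).Z2} {G : E → E}
    (hG : X.HasDefect c z.1 G)
    (h : (QuotientAddGroup.mk z : (X.action s).H2) = QuotientAddGroup.mk z') :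
    ∃ G', X.HasDefect c z'.1 G' := by
  rw [QuotientAddGroup.eq] at h
  obtain ⟨t, ht⟩ := h
  have hσ : ∀ w, ActionTriple.onCenter ((X.action s).sigma 0) w = w := fun w => by
    refine Subtype.ext (X.inc_injective ?_)
    change X.inc (X.sigmaAut (s.toFun 0) w) = _
    rw [inc_sigmaAut, s.map_zero, ← one_eq_zero, inv_one, one_mul, mul_one]
  -- The cocycles are normalised, which forces `t` to be normalised.
  have ht0 : t 0 = 0 := by
    have h0 := (ht 0 0).2
    have h1 : (-z + z').1.2 0 0 = 0 := ((-z + z').2.1 0).2.2.1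
    rwa [h1, hσ, zero_mul_brace, neg_add_cancel, zero_add, eq_comm] at h0
  exact ⟨_, hG.twist s ht0 fun h₁ h₂ =>
    ⟨eq_add_of_neg_add_eq (ht h₁ h₂).1, eq_add_of_neg_add_eq (ht h₁ h₂).2⟩⟩

/-- Defects obey the derivation rule under composition of lifts. -/
theorem comp [IsTrivial I] {s : X.STSection} {c d : (X.action s).stabilizer}
    {z z' : (X.action s).Z2} {G G' : E → E} (hG : X.HasDefect c.1 z.1 G)
    (hG' : X.HasDefect d.1 z'.1 G') :
    X.HasDefect (c * d).1 ((X.action s).actZ2 d z + z').1 (G ∘ G') := by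
  have hE := hG.equivariantLift
  -- `θ_c θ_d` cancels the `θ_d⁻¹` in the action of `d` on cocycles.
  have hθ : ∀ w w' : AddSubgroup.center I,
      X.centerInc (c * d).1.2 (ActionTriple.onCenter d.1.2.toAddEquiv.symm w + w') =
        X.inc (c.1.2 (d.1.2 w')) + X.centerInc c.1.2 w := by
    intro w w'
    rw [add_comm, map_add]
    congr 1
    change X.inc (c.1.2 (d.1.2 (d.1.2.symm w))) = X.inc (c.1.2 w)
    rw [RingEquiv.apply_symm_apply]
  refine ⟨fun a => ?_, fun y => ?_, fun a b => ?_, fun a b => ?_⟩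
  · rw [Function.comp_apply, hG.proj_apply, hG'.proj_apply]
    rfl
  · rw [Function.comp_apply, hG'.apply_inc, hG.apply_inc]
    rfl
  · refine Eq.trans ?_ (congrArg (G (G' (a + b)) + ·) (hθ _ _)).symm
    change G (G' a) + G (G' b) = _
    rw [hG.add_apply, hG'.add_apply, hG'.proj_apply, hG'.proj_apply, centerInc_apply X d.1.2,
      hE.add_inc, add_assoc]
  · refine Eq.trans ?_ (congrArg (G (G' (a * b)) * ·) (hθ _ _)).symm
    change G (G' a) * G (G' b) = _
    rw [hG.mul_apply, hG'.mul_apply, hG'.proj_apply, hG'.proj_apply, centerInc_apply X d.1.2,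
      hE.mul_inc, mul_assoc, centerInc_apply, inc_mul_inc]

end HasDefect

/-- An isomorphism from `X^c` to the translate of `X` by `z` is the inverse of a lift of `c` with
defect `z`, once the translate is identified with `E` as a set. -/
theorem conj_equivalent_translate_iff [IsTrivial I] (X : SkewBraceExt H I E) (s : X.STSection)
    (c : RingAut H × RingAut I) (z : (X.action s).Z2) :
    (X.conj c).Equivalent (X.translate s z) ↔ ∃ G, X.HasDefect c z.1 G := by
  have hinc : ∀ y, Translate.toE X s z ⟨0, y⟩ = X.inc y := fun y => by
    change s.toFun 0 * X.inc y = _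
    rw [s.map_zero, zero_mul_brace]
  constructor
  · rintro ⟨e, he, hp⟩
    let T := Translate.toE X s z
    let G : E → E := fun a => e.symm (T.symm a)
    have hGT : ∀ p, G (T p) = e.symm p := fun p => by simp only [G, Equiv.symm_apply_apply]
    have hGinc : ∀ y, G (X.inc y) = X.inc (c.2 y) := fun y => by
      rw [← hinc, hGT, RingEquiv.symm_apply_eq]
      exact (he y).symm
    have hadd : ∀ p q, G (T p) + G (T q) = G (T p + T q + X.inc (z.1.1 p.1 q.1)) := fun p q => by
      rw [← Translate.toE_add, hGT, hGT, hGT, map_add]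
    have hmul : ∀ p q, G (T p) * G (T q) = G (T p * T q * X.inc (z.1.2 p.1 q.1)) := fun p q => by
      rw [← Translate.toE_mul, hGT, hGT, hGT, map_mul]
    have hadd_inc : ∀ a y, G (a + X.inc y) = G a + X.inc (c.2 y) := fun a y => by
      obtain ⟨p, rfl⟩ := T.surjective a
      have h := hadd p ⟨0, y⟩
      have h0 : z.1.1 p.1 0 = 0 := (z.2.1 _).2.1
      rw [hinc, hGinc, h0, AddSubgroup.coe_zero, X.inc_zero, add_zero] at h
      exact h.symm
    have hmul_inc : ∀ a y, G (a * X.inc y) = G a * X.inc (c.2 y) := fun a y => by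
      obtain ⟨p, rfl⟩ := T.surjective a
      have h := hmul p ⟨0, y⟩
      have h0 : z.1.2 p.1 0 = 0 := (z.2.1 _).2.2.2
      rw [hinc, hGinc, h0, AddSubgroup.coe_zero, X.inc_zero, mul_zero_brace] at h
      exact h.symm
    refine ⟨G, fun a => ?_, hGinc, fun a b => ?_, fun a b => ?_⟩
    · obtain ⟨p, rfl⟩ := T.surjective a
      have h := hp (e.symm p)
      rw [RingEquiv.apply_symm_apply] at h
      rw [hGT, Translate.proj_toE]
      exact (RingEquiv.symm_apply_eq _).1 h.symm
    · obtain ⟨p, rfl⟩ := T.surjective a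
      obtain ⟨q, rfl⟩ := T.surjective b
      rw [hadd, hadd_inc, Translate.proj_toE, Translate.proj_toE]
      rfl
    · obtain ⟨p, rfl⟩ := T.surjective a
      obtain ⟨q, rfl⟩ := T.surjective b
      rw [hmul, hmul_inc, Translate.proj_toE, Translate.proj_toE]
      rfl
  · rintro ⟨G, hG⟩
    have hE := hG.equivariantLift
    let e : Translate X s z ≃+* E :=
      { (Translate.toE X s z).trans (Equiv.ofBijective G hE.bijective) with
        map_add' := fun p q => by
          change G (Translate.toE X s z (p + q)) =
            G (Translate.toE X s z p) + G (Translate.toE X s z q)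
          rw [Translate.toE_add, hE.add_inc, hG.add_apply, Translate.proj_toE,
            Translate.proj_toE]
          rfl
        map_mul' := fun p q => by
          change G (Translate.toE X s z (p * q)) =
            G (Translate.toE X s z p) * G (Translate.toE X s z q)
          rw [Translate.toE_mul, hE.mul_inc, hG.mul_apply, Translate.proj_toE,
            Translate.proj_toE]
          rfl }
    have he : ∀ p, e p = G (Translate.toE X s z p) := fun _ => rfl
    refine ⟨e.symm, fun y => ?_, fun a => ?_⟩
    · rw [RingEquiv.symm_apply_eq, he]
      change X.inc (c.2 y) = G (Translate.toE X s z ⟨0, y⟩)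
      rw [hinc, hG.apply_inc]
    · obtain ⟨p, rfl⟩ := e.surjective a
      rw [RingEquiv.symm_apply_apply]
      change p.1 = c.1.symm (X.proj (e p))
      rw [he, hG.proj_apply, RingEquiv.symm_apply_apply, Translate.proj_toE]

/-! ### The Wells map -/

theorem hasDefect_of_autbI (X : SkewBraceExt H I E) (γ : X.autbI) :
    X.HasDefect (X.rho γ) 0 γ.1 where
  proj_apply a := (X.induced_proj γ a).symm
  apply_inc y := (X.inc_restrict γ y).symm
  add_apply a b := by
    rw [← map_add]
    exact ((congrArg _ (map_zero _)).trans (add_zero _)).symm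
  mul_apply a b := by
    rw [← map_mul]
    exact ((congrArg _ (map_zero _)).trans (mul_zero_brace _)).symm

/-- A lift without defect is an automorphism of `E`. -/
theorem HasDefect.exists_autbI {X : SkewBraceExt H I E} {c : RingAut H × RingAut I} {G : E → E}
    (hG : X.HasDefect c 0 G) : ∃ γ : X.autbI, X.rho γ = c := by
  let γ : RingAut E :=
    { Equiv.ofBijective G hG.equivariantLift.bijective with
      map_add' := fun a b =>
        ((hG.add_apply a b).trans ((congrArg _ (map_zero _)).trans (add_zero _))).symm
      map_mul' := fun a b =>
        ((hG.mul_apply a b).trans ((congrArg _ (map_zero _)).trans (mul_zero_brace _))).symm }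
  have hγ : γ ∈ X.autbI := by
    change γ '' Set.range X.inc = Set.range X.inc
    ext a
    constructor
    · rintro ⟨_, ⟨y, rfl⟩, rfl⟩
      exact ⟨_, (hG.apply_inc y).symm⟩
    · rintro ⟨y, rfl⟩
      refine ⟨_, ⟨c.2.symm y, rfl⟩, (hG.apply_inc _).trans ?_⟩
      rw [RingEquiv.apply_symm_apply]
  refine ⟨⟨γ, hγ⟩, Prod.ext (RingEquiv.ext fun h => ?_) (RingEquiv.ext fun y => ?_)⟩
  · obtain ⟨a, rfl⟩ := X.proj_surjective h
    exact (X.induced_proj ⟨γ, hγ⟩ a).trans (hG.proj_apply a)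
  · exact X.inc_injective ((X.inc_restrict ⟨γ, hγ⟩ y).trans (hG.apply_inc y))

theorem rho_mem_stabilizer [IsTrivial I] (X : SkewBraceExt H I E) (s : X.STSection)
    (γ : X.autbI) : X.rho γ ∈ (X.action s).stabilizer :=
  (X.hasDefect_of_autbI γ).equivariantLift.mem_stabilizer s

variable [IsTrivial I] {X : SkewBraceExt H I E} {s : X.STSection}
  {ω : (X.action s).stabilizer → (X.action s).H2}

theorem exists_isWellsMap (X : SkewBraceExt H I E) (s : X.STSection) :
    ∃ ω, X.IsWellsMap s ω := by
  have h : ∀ c : (X.action s).stabilizer, ∃ z : (X.action s).Z2, ∃ G, X.HasDefect c.1 z.1 G := by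
    intro c
    obtain ⟨G, hG⟩ := X.exists_equivariantLift s c.2
    obtain ⟨z, hz⟩ := hG.exists_hasDefect s
    exact ⟨⟨z, hz.mem_Z2 s⟩, G, hz⟩
  choose z G hG using h
  refine ⟨fun c => QuotientAddGroup.mk (z c), fun c z' => ?_⟩
  rw [conj_equivalent_translate_iff]
  exact ⟨fun ⟨G', hG'⟩ => hG'.mk_eq_mk (hG c), fun h => (hG c).exists_of_mk_eq_mk h.symm⟩

theorem IsWellsMap.mk_eq_iff (hω : X.IsWellsMap s ω) (c : (X.action s).stabilizer)
    (z : (X.action s).Z2) :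
    (QuotientAddGroup.mk z : (X.action s).H2) = ω c ↔ ∃ G, X.HasDefect c.1 z.1 G := by
  rw [← hω c z, conj_equivalent_translate_iff]

theorem IsWellsMap.map_mul (hω : X.IsWellsMap s ω) (c d : (X.action s).stabilizer) :
    ω (c * d) = (X.action s).actH2 d (ω c) + ω d := by
  obtain ⟨z, hz⟩ := QuotientAddGroup.mk_surjective (ω c)
  obtain ⟨z', hz'⟩ := QuotientAddGroup.mk_surjective (ω d)
  obtain ⟨G, hG⟩ := (hω.mk_eq_iff c z).1 hz
  obtain ⟨G', hG'⟩ := (hω.mk_eq_iff d z').1 hz'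
  rw [← (hω.mk_eq_iff _ _).2 ⟨_, hG.comp hG'⟩, ← hz, ← hz']
  rfl

/-- The class `ω(c)` vanishes if and only if `X^c` is equivalent to the translate by zero, that is,
if `c` has a lift without defect. -/
theorem IsWellsMap.eq_zero_iff (hω : X.IsWellsMap s ω) (c : (X.action s).stabilizer) :
    ω c = 0 ↔ ∃ γ, X.rho γ = c.1 := by
  have h := hω.mk_eq_iff c 0
  rw [eq_comm]
  refine h.trans ⟨fun ⟨G, hG⟩ => hG.exists_autbI, fun ⟨γ, hγ⟩ => ⟨γ.1, ?_⟩⟩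
  rw [← hγ]
  exact X.hasDefect_of_autbI γ

end SkewBraceExt

/-! ### An extension whose Wells map is not a homomorphism -/

/-- The trivial skew brace on an additive group: both operations are the given one. The type
synonym keeps `∘` apart from a ring multiplication that `G` may carry. -/
def TrivialBrace (G : Type u) : Type u := G

namespace TrivialBrace

variable {G : Type u} {G' : Type v} {G'' : Type w} [AddGroup G] [AddGroup G'] [AddGroup G'']

instance : AddGroup (TrivialBrace G) := inferInstanceAs (AddGroup G)

instance : Group (TrivialBrace G) := inferInstanceAs (Group (Multiplicative G))

theorem mul_eq_add (a b : TrivialBrace G) : a * b = a + b := rfl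

instance : SkewBrace (TrivialBrace G) where
  mul_add_brace a b c := by
    rw [mul_eq_add, mul_eq_add, mul_eq_add, sub_eq_add_neg, add_assoc, neg_add_cancel_left,
      add_assoc]

instance : SkewBrace.IsTrivial (TrivialBrace G) := ⟨mul_eq_add⟩

/-- A short exact sequence of additive groups, as an extension of trivial skew braces. -/
def ext (i : G →+ G') (p : G' →+ G'') (hi : Function.Injective i) (hp : Function.Surjective p)
    (h : ∀ a, p a = 0 ↔ ∃ y, i y = a) :
    SkewBraceExt (TrivialBrace G'') (TrivialBrace G) (TrivialBrace G') where
  inc := i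
  proj := p
  inc_add := i.map_add
  inc_mul := i.map_add
  inc_injective := hi
  proj_add := p.map_add
  proj_mul := p.map_add
  proj_surjective := hp
  exact := h

/-- An automorphism of an additive group, as an automorphism of the trivial skew brace. -/
def ringAut (f : G ≃+ G) : RingAut (TrivialBrace G) where
  toEquiv := f.toEquiv
  map_add' := f.map_add
  map_mul' := f.map_add

/-- If the middle group is abelian, then the actions are trivial and any pair stabilises the
coupling. -/
theorem mem_stabilizer {G' : Type v} [AddCommGroup G']
    (X : SkewBraceExt (TrivialBrace G'') (TrivialBrace G) (TrivialBrace G')) (s : X.STSection)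
    (c : RingAut (TrivialBrace G'') × RingAut (TrivialBrace G)) :
    c ∈ (X.action s).stabilizer := by
  have hcomm : ∀ a b : TrivialBrace G', -a + b + a = b := neg_add_cancel_comm (G := G')
  have hnu : ∀ a y, X.nuAut a y = y := fun a y => X.inc_injective (by
    rw [SkewBraceExt.inc_nuAut, ActionTriple.lam_of_trivial])
  have hmu : ∀ a y, X.muAut a y = y := fun a y => X.inc_injective (by
    rw [SkewBraceExt.inc_muAut, hcomm])
  have hsigma : ∀ a y, X.sigmaAut a y = y := fun a y => X.inc_injective (by
    rw [SkewBraceExt.inc_sigmaAut, mul_eq_add, mul_eq_add, inv_eq_neg, hcomm])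
  refine (ActionTriple.approx_iff _ _).2 ⟨fun _ => 0, rfl, fun h y => ⟨?_, ?_, ?_⟩⟩ <;>
    simp [ActionTriple.conj, SkewBraceExt.action, hnu, hmu, hsigma]

end TrivialBrace

/-- The extension `0 → ℤ/3 → ℤ/9 → ℤ/3 → 0` of trivial skew braces. -/
def zmodNineExt :
    SkewBraceExt (TrivialBrace (ZMod 3)) (TrivialBrace (ZMod 3)) (TrivialBrace (ZMod 9)) :=
  TrivialBrace.ext (ZMod.lift 3 ⟨(zmultiplesHom (ZMod 9)) 3, by decide⟩)
    (ZMod.castHom (show 3 ∣ 9 by decide) (ZMod 3)).toAddMonoidHom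
    (by decide) (by decide) (by decide)

/-- The section `h ↦ h` with values `0, 1, 2`. -/
def zmodNineSection : zmodNineExt.STSection where
  toFun h := (ZMod.cast (h : ZMod 3) : ZMod 9)
  proj_toFun := by
    change ∀ h : ZMod 3, ZMod.castHom (show 3 ∣ 9 by decide) (ZMod 3) (ZMod.cast h : ZMod 9) = h
    decide
  map_zero := rfl

/-- The pair `(id, -id)`. -/
def zmodNinePair : RingAut (TrivialBrace (ZMod 3)) × RingAut (TrivialBrace (ZMod 3)) :=
  (1, TrivialBrace.ringAut (AddEquiv.neg (ZMod 3)))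

theorem zmodNinePair_mul_self : zmodNinePair * zmodNinePair = 1 :=
  Prod.ext (mul_one 1) (RingEquiv.ext fun y => neg_neg (y : ZMod 3))

/-- An automorphism of `ℤ/9` that is the identity on `ℤ/3` is multiplication by a unit congruent
to `1` modulo `3`, so it is the identity, not `-1`, on the subgroup `3ℤ/9`. -/
theorem rho_ne_zmodNinePair (γ : zmodNineExt.autbI) : zmodNineExt.rho γ ≠ zmodNinePair := by
  intro h
  have h1 := zmodNineExt.induced_proj γ (1 : ZMod 9)
  have h2 := zmodNineExt.inc_restrict γ (1 : ZMod 3)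
  have hH : zmodNineExt.induced γ = 1 := congrArg Prod.fst h
  have hI : zmodNineExt.restrict γ = TrivialBrace.ringAut (AddEquiv.neg (ZMod 3)) :=
    congrArg Prod.snd h
  rw [hH] at h1
  rw [hI] at h2
  let g : ZMod 9 → ZMod 9 := γ.1
  have hg : ∀ a b, g (a + b) = g a + g b := γ.1.map_add
  have h3 : (6 : ZMod 9) = g 1 + g 1 + g 1 := by
    rw [← hg, ← hg]
    exact h2
  have key : ∀ u : ZMod 9, ZMod.castHom (show 3 ∣ 9 by decide) (ZMod 3) 1 =
      ZMod.castHom (show 3 ∣ 9 by decide) (ZMod 3) u → (6 : ZMod 9) ≠ u + u + u := by decide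
  exact key _ h1 h3

/-- The class of the pair is killed by `3`, hence by `2` only if it is zero, whereas the pair
itself has order `2`. -/
theorem not_map_mul_of_isWellsMap_zmodNineExt
    {ω : (zmodNineExt.action zmodNineSection).stabilizer →
      (zmodNineExt.action zmodNineSection).H2}
    (hω : zmodNineExt.IsWellsMap zmodNineSection ω) : ¬ ∀ c d, ω (c * d) = ω c + ω d := by
  intro h
  let c : (zmodNineExt.action zmodNineSection).stabilizer :=
    ⟨zmodNinePair, TrivialBrace.mem_stabilizer _ _ _⟩
  have hcc : c * c = 1 := Subtype.ext zmodNinePair_mul_self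
  have h1 : ω 1 = 0 := by
    have := h 1 1
    rwa [mul_one, left_eq_add] at this
  have h2 : ω c + ω c = 0 := by rw [← h, hcc, h1]
  have h3 : ω c + ω c + ω c = 0 := by
    obtain ⟨z, hz⟩ := QuotientAddGroup.mk_surjective (ω c)
    have hA : ∀ a : ZMod 3, a + a + a = 0 := by decide
    have hzz : z + z + z = 0 := Subtype.ext (Prod.ext
      (funext₂ fun _ _ => Subtype.ext (hA _)) (funext₂ fun _ _ => Subtype.ext (hA _)))
    rw [← hz, ← QuotientAddGroup.mk_add, ← QuotientAddGroup.mk_add, hzz, QuotientAddGroup.mk_zero]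
  rw [h2, zero_add] at h3
  obtain ⟨γ, hγ⟩ := (hω.eq_zero_iff c).1 h3
  exact rho_ne_zmodNinePair γ hγ

/-! ### The Wells exact sequence -/

theorem mainTheorem6 :
    (∀ {H : Type u} {I : Type v} {E : Type w} [SkewBrace H] [SkewBrace I] [SkewBrace E]
      [SkewBrace.IsTrivial I] (X : SkewBraceExt H I E) (s : X.STSection),
      ∃ (hρ : ∀ γ, X.rho γ ∈ (X.action s).stabilizer)
        (ω : (X.action s).stabilizer → (X.action s).H2),
        X.IsWellsMap s ω ∧
        (∀ c d, ω (c * d) = (X.action s).actH2 d (ω c) + ω d) ∧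
        Function.Injective X.autbHI.subtype ∧
        X.autbHI.subtype.range = (X.rho.codRestrict (X.action s).stabilizer hρ).ker ∧
        Set.range (X.rho.codRestrict (X.action s).stabilizer hρ) = {c | ω c = 0}) ∧
    (∃ (H I E : Type) (_ : SkewBrace H) (_ : SkewBrace I) (_ : SkewBrace E)
      (_ : SkewBrace.IsTrivial I) (X : SkewBraceExt H I E) (s : X.STSection)
      (ω : (X.action s).stabilizer → (X.action s).H2),
      X.IsWellsMap s ω ∧ ¬ ∀ c d, ω (c * d) = ω c + ω d) := by
  constructor
  · intro H I E _ _ _ _ X s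
    obtain ⟨ω, hω⟩ := X.exists_isWellsMap s
    refine ⟨X.rho_mem_stabilizer s, ω, hω, hω.map_mul, Subtype.val_injective, ?_, ?_⟩
    · rw [Subgroup.range_subtype]
      ext γ
      rw [MonoidHom.mem_ker, ← Subtype.coe_inj]
      exact ⟨fun h => Prod.ext h.2 h.1, fun h => ⟨congrArg Prod.snd h, congrArg Prod.fst h⟩⟩
    · ext c
      refine Iff.trans ?_ (hω.eq_zero_iff c).symm
      exact exists_congr fun γ => Subtype.ext_iff
  · obtain ⟨ω, hω⟩ := zmodNineExt.exists_isWellsMap zmodNineSection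
    exact ⟨_, _, _, _, _, _, inferInstance, zmodNineExt, zmodNineSection, ω, hω,
      not_map_mul_of_isWellsMap_zmodNineExt hω⟩
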